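/- Let $\mathbb K$ be a field of characteristic zero. A multiquiver $\Gamma=(V,E,s,t)$ consists of sets $V$ (vertices) and $E$ (edges), possibly empty or infinite, and maps $s,t:E\to (V\times\mathbb Z_{>0})\cup\{\emptyset\}$ such that $u\neq v$ whenever $s(e)=(u,m)$ and $t(e)=(v,n)$, and such that for every $v\in V$ only finitely many edges $e$ satisfy $s(e)\in\{v\}\times\mathbb Z_{>0}$ or $t(e)\in\{v\}\times\mathbb Z_{>0}$; such a $v$ is then called incident to $e$. Its incidence matrix is the homomorphism of free abelian groups $\gamma:\mathbb ZV\to\mathbb ZE$, $\gamma(v)=\sum_{e}\gamma_{ev}e$, with $\gamma_{ev}=n$ if $t(e)=(v,n)$, $\gamma_{ev}=-n$ if $s(e)=(v,n)$, and $\gamma_{ev}=0$ otherwise. *The algebra $\mathcal A(\Gamma)$.* Let $R_E=\mathbb K[u_e\mid e\in E]$. For $v\in V$ let $\sigma_v$ be the automorphism of the $\mathbb K$-algebra $R_E$ with $\sigma_v(u_e)=u_e-\gamma_{ev}$, and let $t_v=\prod_{e}u_{ev}$, the product over all edges $e$ incident to $v$, where $u_{ev}=u_e(u_e+1)\cdots(u_e+n-1)$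 if $t(e)=(v,n)$ and $u_{ev}=(u_e-1)(u_e-2)\cdots(u_e-n)$ if $s(e)=(v,n)$. Let $\mathcal C$ be the $R_E$-ring generated by $X_v,Y_v$ $(v\in V)$ subject to the relations $X_vr=\sigma_v(r)X_v$, $Y_vr=\sigma_v^{-1}(r)Y_v$ $(r\in R_E)$, $Y_vX_v=t_v$, $X_vY_v=\sigma_v(t_v)$, and $X_vY_w=Y_wX_v$ for $v\ne w$. It is $\mathbb ZV$-graded by $\deg r=0$, $\deg X_v=v$, $\deg Y_v=-v$. Then $\mathcal A(\Gamma)$ is the quotient of $\mathcal C$ by the sum of all graded two-sided ideals having zero intersection with the degree zero component $\mathcal C_0$ (a twisted generalized Weyl algebra). Below, "$R_E$ in $\mathcal A(\Gamma)$" means the image of the canonical map $R_E\to\mathcal A(\Gamma)$. *The canonical representation.* Let $A_E(\mathbb K)$ be the Weyl algebra, generated by $x_e,y_e$ $(e\in E)$ with relations $[x_e,x_f]=[y_e,y_f]=0$, $[y_e,x_f]=\delta_{ef}$. For $k=\sum_e k_e e\in\mathbb ZE$ put $z^k=\prod_{e}z_e^{(k_e)}$, where $z_e^{(p)}=x_e^p$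 for $p\ge0$ and $z_e^{(p)}=y_e^{-p}$ for $p<0$. *Equilibrium.* A leaf is an edge $e$ with $s(e)=\emptyset$ or $t(e)=\emptyset$. A subgraph of $\Gamma$ is given by subsets $V'\subseteq V$, $E'\subseteq E$ and the restrictions of $s,t$ to $E'$, where values whose vertex is not in $V'$ are replaced by $\emptyset$. A directed cycle is a multiquiver with enumerations $V=\{v_1,\dots,v_n\}$, $E=\{e_1,\dots,e_n\}$ without repetition ($n\ge1$) such that $s(e_i)=(v_i,a_i)$ and $t(e_i)=(v_{i+1},b_i)$ for all $i$, with $v_{n+1}=v_1$; it is balanced if $\prod_i a_i=\prod_i b_i$. An NND (not necessarily directed) cycle is a multiquiver that becomes isomorphic to a directed cycle after reversing some of its edges, that is, interchanging $s(e)$ and $t(e)$ for some edges $e$; it is balanced if it becomes isomorphic in this way to a balanced directed cycle. Connected components are taken with respect to incidence of vertices and edges (an edge with neither source nor target is a component by itself). A connected component $C$ of $\Gamma$ is in equilibrium if it has finitely many vertices and no leaves, and every subgraph of $C$ that is an NND cycle is balanced. **Theorem.** Let $\Gamma=(V,E,s,t)$ be a multiquiver. There is a unique homomorphism of $\mathbb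 K$-algebras $\varphi_\Gamma:\mathcal A(\Gamma)\to A_E(\mathbb K)$ with $\varphi_\Gamma(X_v)=z^{\gamma(v)}$, $\varphi_\Gamma(Y_v)=z^{-\gamma(v)}$ for $v\in V$ and $\varphi_\Gamma(u_e)=y_ex_e$ for $e\in E$ (the canonical representation by differential operators), and the following statements are equivalent: 1. $\varphi_\Gamma$ is injective; 2. $\gamma$ is injective; 3. $R_E$ is a maximal commutative subalgebra of $\mathcal A(\Gamma)$; 4. no connected component of $\Gamma$ is in equilibrium. -/

import Mathlib

noncomputable section

/-! ### Twisted generalized Weyl algebras -/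

/-- A twisted generalized Weyl datum `(R, σ, t)` over `K` with index set `I`. -/
structure TGWDatum (K R I : Type*) [Field K] [Ring R] [Algebra K R] where
  /-- the commuting automorphisms -/
  σ : I → R ≃ₐ[K] R
  /-- the nonzero central elements -/
  t : I → R
  σ_comm : ∀ i j r, σ i (σ j r) = σ j (σ i r)
  t_ne_zero : ∀ i, t i ≠ 0
  t_central : ∀ i r, t i * r = r * t i

/-- Generators of the twisted generalized Weyl construction: the elements of `R`, and symbols
`X i`, `Y i` for `i : I`. -/
inductive TGWGen (R I : Type*) where
  | coeff (r : R) : TGWGen R I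
  | X (i : I) : TGWGen R I
  | Y (i : I) : TGWGen R I

/-- The degree in `ℤ I` of a generator: `deg r = 0`, `deg X i = i`, `deg Y i = -i`. -/
def TGWGen.deg {R I : Type*} : TGWGen R I → (I →₀ ℤ)
  | .coeff _ => 0
  | .X i => Finsupp.single i 1
  | .Y i => -Finsupp.single i 1

namespace TGWDatum

variable {K R I : Type*} [Field K] [Ring R] [Algebra K R]

/-- Defining relations of the twisted generalized Weyl construction. The first three say that
`R` maps to the quotient by a homomorphism of `K`-algebras, so that the quotient is the quotient of
the free `R`-ring on the `X i`, `Y i` by the remaining relations (these force `K` to be central). -/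
inductive Rel (D : TGWDatum K R I) (μ : I → I → Kˣ) :
    FreeAlgebra K (TGWGen R I) → FreeAlgebra K (TGWGen R I) → Prop
  | coeff_add (r s : R) : Rel D μ (FreeAlgebra.ι K (.coeff (r + s)))
      (FreeAlgebra.ι K (.coeff r) + FreeAlgebra.ι K (.coeff s))
  | coeff_mul (r s : R) : Rel D μ (FreeAlgebra.ι K (.coeff (r * s)))
      (FreeAlgebra.ι K (.coeff r) * FreeAlgebra.ι K (.coeff s))
  | coeff_algebraMap (k : K) : Rel D μ (FreeAlgebra.ι K (.coeff (algebraMap K R k)))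
      (algebraMap K (FreeAlgebra K (TGWGen R I)) k)
  | X_coeff (i : I) (r : R) : Rel D μ (FreeAlgebra.ι K (.X i) * FreeAlgebra.ι K (.coeff r))
      (FreeAlgebra.ι K (.coeff (D.σ i r)) * FreeAlgebra.ι K (.X i))
  | Y_coeff (i : I) (r : R) : Rel D μ (FreeAlgebra.ι K (.Y i) * FreeAlgebra.ι K (.coeff r))
      (FreeAlgebra.ι K (.coeff ((D.σ i).symm r)) * FreeAlgebra.ι K (.Y i))
  | Y_X (i : I) : Rel D μ (FreeAlgebra.ι K (.Y i) * FreeAlgebra.ι K (.X i))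
      (FreeAlgebra.ι K (.coeff (D.t i)))
  | X_Y (i : I) : Rel D μ (FreeAlgebra.ι K (.X i) * FreeAlgebra.ι K (.Y i))
      (FreeAlgebra.ι K (.coeff (D.σ i (D.t i))))
  | X_Y_ne (i j : I) (h : i ≠ j) : Rel D μ (FreeAlgebra.ι K (.X i) * FreeAlgebra.ι K (.Y j))
      ((μ i j : K) • (FreeAlgebra.ι K (.Y j) * FreeAlgebra.ι K (.X i)))

variable (D : TGWDatum K R I) (μ : I → I → Kˣ)

/-- The twisted generalized Weyl construction `C_μ(R, σ, t)`. The diagonal of `μ` is not used. -/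
abbrev Construction : Type _ := RingQuot (D.Rel μ)

/-- The image of a generator in the construction. -/
def Construction.gen (g : TGWGen R I) : D.Construction μ :=
  RingQuot.mkAlgHom K (D.Rel μ) (FreeAlgebra.ι K g)

/-- The component of degree `d` of the construction: the span of the words of degree `d` in the
generators. -/
def Construction.component (d : I →₀ ℤ) : Submodule K (D.Construction μ) :=
  Submodule.span K {x | ∃ w : List (TGWGen R I),
    (w.map TGWGen.deg).sum = d ∧ (w.map (Construction.gen D μ)).prod = x}

/-- An ideal is graded if it is spanned by its homogeneous elements. -/
def IsGradedIdeal (J : Ideal (D.Construction μ)) : Prop :=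
  ∀ a ∈ J, a ∈ Submodule.span K {b | b ∈ J ∧ ∃ d, b ∈ Construction.component D μ d}

/-- The sum of all graded two-sided ideals having zero intersection with the component of
degree zero. -/
def radicalIdeal : Ideal (D.Construction μ) :=
  sSup {J | J.IsTwoSided ∧ D.IsGradedIdeal μ J ∧
    ∀ a ∈ J, a ∈ Construction.component D μ 0 → a = 0}

instance radicalIdeal_isTwoSided : (D.radicalIdeal μ).IsTwoSided where
  mul_mem_of_left {a} b ha := by
    unfold radicalIdeal at ha ⊢
    rw [sSup_eq_iSup'] at ha ⊢
    refine Submodule.iSup_induction (motive := fun x => x * b ∈ _) _ ha ?_ (by simp) ?_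
    · intro J x hx
      have := J.2.1
      exact Submodule.mem_iSup_of_mem J (Ideal.IsTwoSided.mul_mem_of_left b hx)
    · intro x y hx hy
      rw [add_mul]
      exact add_mem hx hy

/-- The twisted generalized Weyl algebra `A_μ(R, σ, t)`. -/
abbrev TGWAlgebra : Type _ := D.Construction μ ⧸ D.radicalIdeal μ

/-- The image of a generator in the twisted generalized Weyl algebra. -/
def TGWAlgebra.gen (g : TGWGen R I) : D.TGWAlgebra μ :=
  Ideal.Quotient.mk (D.radicalIdeal μ) (Construction.gen D μ g)

/-- The canonical homomorphism `ρ : R → A_μ(R, σ, t)`. -/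
def TGWAlgebra.ρ : R →ₐ[K] D.TGWAlgebra μ :=
  (Ideal.Quotient.mkₐ K (D.radicalIdeal μ)).comp <|
    AlgHom.ofLinearMap
      { toFun := fun r => Construction.gen D μ (.coeff r)
        map_add' := fun r s => by
          simpa [Construction.gen] using RingQuot.mkAlgHom_rel K (Rel.coeff_add (D := D) (μ := μ) r s)
        map_smul' := fun k r => by
          have h₁ := RingQuot.mkAlgHom_rel K
            (Rel.coeff_mul (D := D) (μ := μ) (algebraMap K R k) r)
          have h₂ := RingQuot.mkAlgHom_rel K (Rel.coeff_algebraMap (D := D) (μ := μ) k)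
          rw [map_mul, h₂, AlgHom.commutes, ← Algebra.smul_def, ← Algebra.smul_def] at h₁
          exact h₁ }
      (by
        have h := RingQuot.mkAlgHom_rel K (Rel.coeff_algebraMap (D := D) (μ := μ) 1)
        simpa [Construction.gen] using h)
      (fun r s => by
        simpa [Construction.gen] using RingQuot.mkAlgHom_rel K (Rel.coeff_mul (D := D) (μ := μ) r s))

end TGWDatum

/-! ### The Weyl algebra -/

/-- Generators of the Weyl algebra with index set `E`. -/
inductive WeylGen (E : Type*) where
  | x (e : E) : WeylGen E
  | y (e : E) : WeylGen E

open Classical in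
/-- Defining relations `[x_e, x_f] = [y_e, y_f] = [y_e, x_f] - δ_{ef} = 0`. -/
inductive WeylRel (K E : Type*) [Field K] :
    FreeAlgebra K (WeylGen E) → FreeAlgebra K (WeylGen E) → Prop
  | x_x (e f : E) : WeylRel K E (FreeAlgebra.ι K (.x e) * FreeAlgebra.ι K (.x f))
      (FreeAlgebra.ι K (.x f) * FreeAlgebra.ι K (.x e))
  | y_y (e f : E) : WeylRel K E (FreeAlgebra.ι K (.y e) * FreeAlgebra.ι K (.y f))
      (FreeAlgebra.ι K (.y f) * FreeAlgebra.ι K (.y e))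
  | y_x (e f : E) : WeylRel K E (FreeAlgebra.ι K (.y e) * FreeAlgebra.ι K (.x f))
      (FreeAlgebra.ι K (.x f) * FreeAlgebra.ι K (.y e) + if e = f then 1 else 0)

/-- The Weyl algebra `A_E(K)`. -/
abbrev WeylAlgebra (K E : Type*) [Field K] : Type _ := RingQuot (WeylRel K E)

namespace WeylAlgebra

variable (K : Type*) {E : Type*} [Field K]

/-- The generator `x_e`. -/
def x (e : E) : WeylAlgebra K E := RingQuot.mkAlgHom K (WeylRel K E) (FreeAlgebra.ι K (.x e))

/-- The generator `y_e`. -/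
def y (e : E) : WeylAlgebra K E := RingQuot.mkAlgHom K (WeylRel K E) (FreeAlgebra.ι K (.y e))

/-- `z_e^{(p)}`, which is `x_e ^ p` for `p ≥ 0` and `y_e ^ (-p)` for `p < 0`. -/
def zPow (e : E) (p : ℤ) : WeylAlgebra K E :=
  if 0 ≤ p then x K e ^ p.toNat else y K e ^ (-p).toNat

theorem zPow_commute {e f : E} (h : e ≠ f) (p q : ℤ) : Commute (zPow K e p) (zPow K f q) := by
  have hxx : Commute (x K e) (x K f) := by
    simpa [x, Commute, SemiconjBy] using RingQuot.mkAlgHom_rel K (WeylRel.x_x (K := K) e f)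
  have hyy : Commute (y K e) (y K f) := by
    simpa [y, Commute, SemiconjBy] using RingQuot.mkAlgHom_rel K (WeylRel.y_y (K := K) e f)
  have hyx : Commute (y K e) (x K f) := by
    simpa [x, y, Commute, SemiconjBy, h] using RingQuot.mkAlgHom_rel K (WeylRel.y_x (K := K) e f)
  have hxy : Commute (x K e) (y K f) := by
    have := RingQuot.mkAlgHom_rel K (WeylRel.y_x (K := K) f e)
    simpa [x, y, Commute, SemiconjBy, h.symm, eq_comm] using this
  unfold zPow
  split_ifs
  · exact hxx.pow_pow _ _
  · exact hxy.pow_pow _ _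
  · exact hyx.pow_pow _ _
  · exact hyy.pow_pow _ _

/-- `z^k = ∏_e z_e^{(k_e)}` for `k ∈ ℤ E` (the factors commute). -/
def z (k : E →₀ ℤ) : WeylAlgebra K E :=
  k.support.noncommProd (fun e => zPow K e (k e)) fun _ _ _ _ h => zPow_commute K h _ _

end WeylAlgebra

/-! ### Multiquivers -/

/-- A multiquiver with vertex set `V` and edge set `E`; `none` means that the edge has no source
(respectively no target). -/
structure Multiquiver (V E : Type*) where
  /-- source of an edge, with the outgoing multiplicity -/
  s : E → Option (V × ℕ+)
  /-- target of an edge, with the incoming multiplicity -/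
  t : E → Option (V × ℕ+)
  no_loops : ∀ e u m v n, s e = some (u, m) → t e = some (v, n) → u ≠ v
  finite_s : ∀ v, {e | ∃ n, s e = some (v, n)}.Finite
  finite_t : ∀ v, {e | ∃ n, t e = some (v, n)}.Finite

namespace Multiquiver

variable {V E : Type*} (Γ : Multiquiver V E)

open Classical in
/-- The multiplicity at `v` of a source or target `o`; it is `0` if the vertex is not `v`. -/
def multAt (o : Option (V × ℕ+)) (v : V) : ℕ :=
  match o with
  | none => 0
  | some (w, n) => if w = v then n else 0

theorem multAt_ne_zero {o : Option (V × ℕ+)} {v : V} (h : multAt o v ≠ 0) :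
    ∃ n, o = some (v, n) := by
  rcases o with _ | ⟨w, n⟩
  · simp [multAt] at h
  · by_cases hw : w = v
    · exact ⟨n, by rw [hw]⟩
    · simp [multAt, hw] at h

/-- The vertex `v` is incident to the edge `e`. -/
def Incident (v : V) (e : E) : Prop :=
  (∃ n, Γ.s e = some (v, n)) ∨ ∃ n, Γ.t e = some (v, n)

theorem finite_incident (v : V) : {e | Γ.Incident v e}.Finite :=
  (Γ.finite_s v).union (Γ.finite_t v)

/-! #### The incidence matrix -/

/-- The entry `γ_{ev}` of the incidence matrix. -/
def entry (e : E) (v : V) : ℤ := (multAt (Γ.t e) v : ℤ) - multAt (Γ.s e) v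

theorem entry_support_finite (v : V) : (Function.support fun e => Γ.entry e v).Finite := by
  refine (Γ.finite_incident v).subset fun e he => ?_
  by_contra h
  have h₁ : multAt (Γ.s e) v = 0 := by
    by_contra h'
    exact h (Or.inl (multAt_ne_zero h'))
  have h₂ : multAt (Γ.t e) v = 0 := by
    by_contra h'
    exact h (Or.inr (multAt_ne_zero h'))
  exact he (by simp [entry, h₁, h₂])

/-- The column `γ(v) = ∑_e γ_{ev} e ∈ ℤ E`. -/
def column (v : V) : E →₀ ℤ :=
  Finsupp.ofSupportFinite (fun e => Γ.entry e v) (Γ.entry_support_finite v)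

/-- The incidence matrix, as a homomorphism `γ : ℤ V → ℤ E`. -/
def γ : (V →₀ ℤ) →ₗ[ℤ] (E →₀ ℤ) := Finsupp.linearCombination ℤ Γ.column

/-! #### The algebra `A(Γ)` -/

section algebra

variable (K : Type*) [Field K]

/-- The automorphism `σ_v` of `R_E = K[u_e | e ∈ E]`, `σ_v(u_e) = u_e - γ_{ev}`. -/
def σ (v : V) : MvPolynomial E K ≃ₐ[K] MvPolynomial E K :=
  AlgEquiv.ofAlgHom
    (MvPolynomial.aeval fun e => MvPolynomial.X e - MvPolynomial.C (Γ.entry e v : K))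
    (MvPolynomial.aeval fun e => MvPolynomial.X e + MvPolynomial.C (Γ.entry e v : K))
    (by ext e : 1; simp)
    (by ext e : 1; simp)

/-- The polynomial `u_{ev}`: it is `u_e (u_e + 1) ⋯ (u_e + n - 1)` if `t(e) = (v, n)`, and
`(u_e - 1) ⋯ (u_e - n)` if `s(e) = (v, n)`. At most one of the two products is nonempty. -/
def uEdge (e : E) (v : V) : MvPolynomial E K :=
  (∏ i ∈ Finset.range (multAt (Γ.t e) v), (MvPolynomial.X e + MvPolynomial.C (i : K))) *
    ∏ i ∈ Finset.range (multAt (Γ.s e) v), (MvPolynomial.X e - MvPolynomial.C ((i : K) + 1))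

/-- `t_v`, the product of the `u_{ev}` over the edges `e` incident to `v`. -/
def tElt (v : V) : MvPolynomial E K := ∏ e ∈ (Γ.finite_incident v).toFinset, Γ.uEdge K e v

theorem X_add_C_ne_zero (e : E) (c : K) :
    (MvPolynomial.X e + MvPolynomial.C c : MvPolynomial E K) ≠ 0 := by
  intro h
  have := congrArg (MvPolynomial.eval fun _ => 1 - c) h
  simp at this

theorem tElt_ne_zero (v : V) : Γ.tElt K v ≠ 0 := by
  refine Finset.prod_ne_zero_iff.2 fun e _ => mul_ne_zero ?_ ?_
  · exact Finset.prod_ne_zero_iff.2 fun i _ => X_add_C_ne_zero K e _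
  · refine Finset.prod_ne_zero_iff.2 fun i _ => ?_
    rw [sub_eq_add_neg, ← map_neg]
    exact X_add_C_ne_zero K e _

/-- The twisted generalized Weyl datum `(R_E, σ^Γ, t^Γ)`. -/
def datum : TGWDatum K (MvPolynomial E K) V where
  σ := Γ.σ K
  t := Γ.tElt K
  σ_comm v w r := by
    have h : (Γ.σ K v).toAlgHom.comp (Γ.σ K w).toAlgHom =
        (Γ.σ K w).toAlgHom.comp (Γ.σ K v).toAlgHom := by
      ext e : 1
      simp [σ]
      ring
    exact DFunLike.congr_fun h r
  t_ne_zero := Γ.tElt_ne_zero K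
  t_central _ _ := mul_comm _ _

/-- The algebra `A(Γ)`, the twisted generalized Weyl algebra with `μ_{ij} = 1` for all `i, j`. -/
abbrev Alg : Type _ := (Γ.datum K).TGWAlgebra 1

/-- The generator `X_v` of `A(Γ)`. -/
def X (v : V) : Γ.Alg K := TGWDatum.TGWAlgebra.gen (Γ.datum K) 1 (.X v)

/-- The generator `Y_v` of `A(Γ)`. -/
def Y (v : V) : Γ.Alg K := TGWDatum.TGWAlgebra.gen (Γ.datum K) 1 (.Y v)

/-- The canonical homomorphism `ρ : R_E → A(Γ)`. -/
def ρ : MvPolynomial E K →ₐ[K] Γ.Alg K := TGWDatum.TGWAlgebra.ρ (Γ.datum K) 1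

/-- `φ` is the canonical representation `A(Γ) → A_E(K)` by differential operators: the
homomorphism determined by its values on the generators. -/
structure IsCanonicalRep {K : Type*} [Field K] (φ : Γ.Alg K →ₐ[K] WeylAlgebra K E) : Prop where
  map_X : ∀ v, φ (Γ.X K v) = WeylAlgebra.z K (Γ.γ (Finsupp.single v 1))
  map_Y : ∀ v, φ (Γ.Y K v) = WeylAlgebra.z K (-Γ.γ (Finsupp.single v 1))
  map_u : ∀ e, φ (Γ.ρ K (MvPolynomial.X e)) = WeylAlgebra.y K e * WeylAlgebra.x K e

end algebra

/-! #### Subgraphs, cycles, components -/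

open Classical in
/-- Forget a source or target that is not in `V'`. -/
def restrictEnd (V' : Set V) : Option (V × ℕ+) → Option (V' × ℕ+)
  | none => none
  | some (v, n) => if h : v ∈ V' then some (⟨v, h⟩, n) else none

theorem restrictEnd_eq_some {V' : Set V} {o : Option (V × ℕ+)} {v : V'} {n : ℕ+}
    (h : restrictEnd V' o = some (v, n)) : o = some (v.1, n) := by
  rcases o with _ | ⟨w, m⟩
  · simp [restrictEnd] at h
  · by_cases hw : w ∈ V'
    · simp only [restrictEnd, hw, dite_true, Option.some.injEq, Prod.mk.injEq] at h
      rw [← h.1, ← h.2]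
    · simp [restrictEnd, hw] at h

/-- The subgraph of `Γ` with vertex set `V'` and edge set `E'`. -/
def subgraph (V' : Set V) (E' : Set E) : Multiquiver V' E' where
  s e := restrictEnd V' (Γ.s e)
  t e := restrictEnd V' (Γ.t e)
  no_loops e u m v n hs ht h := Γ.no_loops e u m v n (restrictEnd_eq_some hs)
    (restrictEnd_eq_some ht) (congrArg Subtype.val h)
  finite_s v := Set.Finite.of_finite_image ((Γ.finite_s v).subset (by
    rintro _ ⟨e, ⟨n, hn⟩, rfl⟩
    exact ⟨n, restrictEnd_eq_some hn⟩)) Subtype.val_injective.injOn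
  finite_t v := Set.Finite.of_finite_image ((Γ.finite_t v).subset (by
    rintro _ ⟨e, ⟨n, hn⟩, rfl⟩
    exact ⟨n, restrictEnd_eq_some hn⟩)) Subtype.val_injective.injOn

/-- The enumerations `v`, `e` exhibit `Γ` as a directed cycle with outgoing multiplicities `a` and
incoming multiplicities `b` (indices are cyclic). -/
def IsDirectedCycleVia {n : ℕ} (v : Fin n ≃ V) (e : Fin n ≃ E) (a b : Fin n → ℕ+) : Prop :=
  ∀ i, Γ.s (e i) = some (v i, a i) ∧ Γ.t (e i) = some (v (finRotate n i), b i)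

/-- `Γ` is a directed cycle. -/
def IsDirectedCycle : Prop :=
  ∃ (n : ℕ) (v : Fin n ≃ V) (e : Fin n ≃ E) (a b : Fin n → ℕ+),
    0 < n ∧ Γ.IsDirectedCycleVia v e a b

/-- `Γ` is a directed cycle in which the product of the outgoing multiplicities equals the product
of the incoming multiplicities. -/
def IsBalancedDirectedCycle : Prop :=
  ∃ (n : ℕ) (v : Fin n ≃ V) (e : Fin n ≃ E) (a b : Fin n → ℕ+),
    0 < n ∧ Γ.IsDirectedCycleVia v e a b ∧ ∏ i, a i = ∏ i, b i

/-- Two multiquivers are sign-equivalent if they become isomorphic after changing the direction of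
some edges. -/
def SignEquivalent {V₁ E₁ V₂ E₂ : Type*} (Γ₁ : Multiquiver V₁ E₁) (Γ₂ : Multiquiver V₂ E₂) : Prop :=
  ∃ (f : V₁ ≃ V₂) (g : E₁ ≃ E₂), ∀ e,
    (Γ₂.s (g e) = (Γ₁.s e).map (Prod.map f id) ∧ Γ₂.t (g e) = (Γ₁.t e).map (Prod.map f id)) ∨
    (Γ₂.s (g e) = (Γ₁.t e).map (Prod.map f id) ∧ Γ₂.t (g e) = (Γ₁.s e).map (Prod.map f id))

/-- `Γ` is a not necessarily directed cycle: it is sign-equivalent to a directed cycle (which may be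
taken to have the same vertex and edge sets). -/
def IsNNDCycle : Prop := ∃ Γ' : Multiquiver V E, Γ'.IsDirectedCycle ∧ SignEquivalent Γ Γ'

/-- `Γ` is a balanced not necessarily directed cycle: it is sign-equivalent to a balanced directed
cycle. -/
def IsBalancedNNDCycle : Prop :=
  ∃ Γ' : Multiquiver V E, Γ'.IsBalancedDirectedCycle ∧ SignEquivalent Γ Γ'

/-- A leaf is an edge without source or without target (or both). -/
def IsLeaf (e : E) : Prop := Γ.s e = none ∨ Γ.t e = none

/-- The graph on vertices and edges of `Γ` whose adjacency is incidence. Its connected components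
are the connected components of `Γ`, described by their vertices and edges. -/
def incidenceGraph : SimpleGraph (V ⊕ E) where
  Adj
    | .inl v, .inr e => Γ.Incident v e
    | .inr e, .inl v => Γ.Incident v e
    | _, _ => False
  symm := ⟨by rintro (v | e) (w | f) h <;> exact h⟩
  loopless := ⟨by rintro (v | e) h <;> exact h⟩

/-- A connected component of `Γ`; an edge without source and target is a component by itself. -/
abbrev Component : Type _ := Γ.incidenceGraph.ConnectedComponent

/-- The connected component `C`, as a subgraph of `Γ`. -/
def componentSubgraph (C : Γ.Component) :
    Multiquiver {v : V | Γ.incidenceGraph.connectedComponentMk (.inl v) = C}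
      {e : E | Γ.incidenceGraph.connectedComponentMk (.inr e) = C} :=
  Γ.subgraph _ _

/-- `Γ` has finitely many vertices, no leaves, and every not necessarily directed cycle in `Γ` is
balanced. -/
def InEquilibrium : Prop :=
  Finite V ∧ (∀ e, ¬Γ.IsLeaf e) ∧
    ∀ (V' : Set V) (E' : Set E), (Γ.subgraph V' E').IsNNDCycle →
      (Γ.subgraph V' E').IsBalancedNNDCycle

end Multiquiver

end

/-! Everything is read off from difference operators. The Weyl algebra acts on polynomials in the
`u_e`, with `x_e` as the translation `u_e ↦ u_e - 1` and `y_e` as the inverse translation followed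
by multiplication by `u_e`; then `z^k` is the translation by `k` followed by multiplication by a
nonzero polynomial. In characteristic zero distinct translations are distinct multiplicative maps,
hence linearly independent over polynomials by Dedekind's lemma, so the action is faithful
(`diffRep_injective`). The relations behind φ thereby become identities between products of linear
polynomials.

The radical is controlled by recording degrees in the group algebra of `ℤV` over the Weyl algebra.
Since the `z^k` are left regular and `R_E` embeds, the kernel of the degree-recording map is exactly
the radical (`Regular.radicalIdeal_eq`). Thus `A(Γ)` embeds in that group algebra, and φ arises by
forgetting the degree. An element of degree `d` acts as a polynomial times the translation by
`γ(d)`. If `γ` is injective, different degrees cannot cancel, so φ is injective; and an element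
commuting with all `u_e` lives in degree zero. If `γ(d) = 0` with `d ≠ 0`, some nonzero element of
degree `d` is sent to a polynomial; it commutes with `R_E`, lies outside it and has the same image
as an element of it, so injectivity and maximality both fail (`exists_not_mem_range_ρ`).

A vector `k` lies in the kernel of `γ` when `m k(u) = n k(v)` along every edge with two ends and `k`
vanishes at the end of every leaf. The support of such a `k` is a union of components, each in
equilibrium. Conversely, on a component in equilibrium a kernel vector is found by multiplying
ratios of multiplicities along walks from a base vertex. This is well defined because closed walks
decompose into NND cycles and back-and-forth steps (`prod_eq_prod_of_closed`); finiteness allows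
denominators to be cleared. -/

noncomputable section

/-! ### Representations and grading of the twisted generalized Weyl construction -/

namespace TGWDatum

variable {K R I : Type*} [Field K] [Ring R] [Algebra K R]

/-- The data of a representation of the twisted generalized Weyl construction (with `μ = 1`) in a
`K`-algebra `B`. -/
structure IsRep (D : TGWDatum K R I) {B : Type*} [Ring B] [Algebra K B] (f : R →ₐ[K] B)
    (x y : I → B) : Prop where
  x_coeff : ∀ i r, x i * f r = f (D.σ i r) * x i
  y_coeff : ∀ i r, y i * f r = f ((D.σ i).symm r) * y i
  y_x : ∀ i, y i * x i = f (D.t i)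
  x_y : ∀ i, x i * y i = f (D.σ i (D.t i))
  x_y_comm : ∀ i j, i ≠ j → x i * y j = y j * x i

/-- The value of a representation on a generator. -/
def genVal {B : Type*} (f : R → B) (x y : I → B) : TGWGen R I → B
  | .coeff r => f r
  | .X i => x i
  | .Y i => y i

namespace Construction

variable (D : TGWDatum K R I)

theorem gen_coeff_add (r s : R) :
    gen D 1 (.coeff (r + s)) = gen D 1 (.coeff r) + gen D 1 (.coeff s) := by
  simpa [gen] using RingQuot.mkAlgHom_rel K (Rel.coeff_add (D := D) (μ := 1) r s)

theorem gen_coeff_mul (r s : R) :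
    gen D 1 (.coeff (r * s)) = gen D 1 (.coeff r) * gen D 1 (.coeff s) := by
  simpa [gen] using RingQuot.mkAlgHom_rel K (Rel.coeff_mul (D := D) (μ := 1) r s)

theorem gen_coeff_algebraMap (k : K) :
    gen D 1 (.coeff (algebraMap K R k)) = algebraMap K _ k := by
  simpa [gen] using RingQuot.mkAlgHom_rel K (Rel.coeff_algebraMap (D := D) (μ := 1) k)

theorem gen_coeff_one : gen D 1 (.coeff 1) = 1 := by
  simpa using gen_coeff_algebraMap D 1

theorem gen_X_coeff (i : I) (r : R) :
    gen D 1 (.X i) * gen D 1 (.coeff r) = gen D 1 (.coeff (D.σ i r)) * gen D 1 (.X i) := by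
  simpa [gen] using RingQuot.mkAlgHom_rel K (Rel.X_coeff (D := D) (μ := 1) i r)

theorem gen_Y_coeff (i : I) (r : R) :
    gen D 1 (.Y i) * gen D 1 (.coeff r) = gen D 1 (.coeff ((D.σ i).symm r)) * gen D 1 (.Y i) := by
  simpa [gen] using RingQuot.mkAlgHom_rel K (Rel.Y_coeff (D := D) (μ := 1) i r)

theorem gen_Y_X (i : I) : gen D 1 (.Y i) * gen D 1 (.X i) = gen D 1 (.coeff (D.t i)) := by
  simpa [gen] using RingQuot.mkAlgHom_rel K (Rel.Y_X (D := D) (μ := 1) i)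

theorem gen_X_Y (i : I) :
    gen D 1 (.X i) * gen D 1 (.Y i) = gen D 1 (.coeff (D.σ i (D.t i))) := by
  simpa [gen] using RingQuot.mkAlgHom_rel K (Rel.X_Y (D := D) (μ := 1) i)

theorem gen_X_Y_comm {i j : I} (h : i ≠ j) : Commute (gen D 1 (.X i)) (gen D 1 (.Y j)) := by
  simpa [gen, Commute, SemiconjBy] using
    RingQuot.mkAlgHom_rel K (Rel.X_Y_ne (D := D) (μ := 1) i j h)

/-- The coefficient homomorphism into the construction. -/
def coeffHom : R →ₐ[K] D.Construction 1 :=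
  AlgHom.ofLinearMap
    { toFun := fun r => gen D 1 (.coeff r)
      map_add' := gen_coeff_add D
      map_smul' := fun k r => by
        rw [Algebra.smul_def, gen_coeff_mul, gen_coeff_algebraMap, ← Algebra.smul_def]
        rfl }
    (gen_coeff_one D) (gen_coeff_mul D)

theorem coeffHom_apply (r : R) : coeffHom D r = gen D 1 (.coeff r) := rfl

variable {D} {B : Type*} [Ring B] [Algebra K B]

/-- The homomorphism from the construction given by a representation. -/
def lift {f : R →ₐ[K] B} {x y : I → B} (h : D.IsRep f x y) : D.Construction 1 →ₐ[K] B :=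
  RingQuot.liftAlgHom K ⟨FreeAlgebra.lift K (genVal f x y), by
    intro a b hab
    induction hab with
    | coeff_add r s => simp [genVal]
    | coeff_mul r s => simp [genVal]
    | coeff_algebraMap k => simp [genVal]
    | X_coeff i r => simpa [genVal] using h.x_coeff i r
    | Y_coeff i r => simpa [genVal] using h.y_coeff i r
    | Y_X i => simpa [genVal] using h.y_x i
    | X_Y i => simpa [genVal] using h.x_y i
    | X_Y_ne i j hij => simpa [genVal] using h.x_y_comm i j hij⟩

@[simp]
theorem lift_gen {f : R →ₐ[K] B} {x y : I → B} (h : D.IsRep f x y) (g : TGWGen R I) :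
    lift h (gen D 1 g) = genVal f x y g := by
  simp [lift, gen]

theorem hom_ext {φ ψ : D.Construction 1 →ₐ[K] B}
    (h : ∀ g, φ (gen D 1 g) = ψ (gen D 1 g)) : φ = ψ :=
  RingQuot.ringQuot_ext' K _ _ (FreeAlgebra.hom_ext (funext h))

variable (D)

/-! #### Homogeneous components -/

theorem one_mem_component : (1 : D.Construction 1) ∈ component D 1 0 :=
  Submodule.subset_span ⟨[], by simp, by simp⟩

theorem word_mem_component (w : List (TGWGen R I)) :
    (w.map (gen D 1)).prod ∈ component D 1 (w.map TGWGen.deg).sum :=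
  Submodule.subset_span ⟨w, rfl, rfl⟩

theorem gen_mem_component (g : TGWGen R I) : gen D 1 g ∈ component D 1 g.deg :=
  Submodule.subset_span ⟨[g], by simp, by simp⟩

variable {D} in
theorem mul_mem_component {a b : D.Construction 1} {c d : I →₀ ℤ} (ha : a ∈ component D 1 c)
    (hb : b ∈ component D 1 d) : a * b ∈ component D 1 (c + d) := by
  induction ha using Submodule.span_induction with
  | zero => simp
  | add a a' _ _ h h' => rw [add_mul]; exact add_mem h h'
  | smul k a _ h => rw [smul_mul_assoc]; exact Submodule.smul_mem _ _ h
  | mem a ha =>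
    obtain ⟨w, rfl, rfl⟩ := ha
    induction hb using Submodule.span_induction with
    | zero => simp
    | add a a' _ _ h h' => rw [mul_add]; exact add_mem h h'
    | smul k a _ h => rw [mul_smul_comm]; exact Submodule.smul_mem _ _ h
    | mem b hb =>
      obtain ⟨w', rfl, rfl⟩ := hb
      exact Submodule.subset_span ⟨w ++ w', by simp, by simp⟩

/-- Homogeneous elements include the scalars and generators and are closed under products. Only
spanning is needed: independence of degrees is supplied later by the group algebra. -/
theorem iSup_component : ⨆ d, component D 1 d = ⊤ := by
  rw [eq_top_iff]
  rintro a -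
  obtain ⟨a, rfl⟩ := RingQuot.mkAlgHom_surjective K (D.Rel 1) a
  induction a using FreeAlgebra.induction with
  | grade0 k =>
    rw [AlgHom.commutes, Algebra.algebraMap_eq_smul_one]
    exact Submodule.smul_mem _ _ (Submodule.mem_iSup_of_mem 0 (one_mem_component D))
  | grade1 g => exact Submodule.mem_iSup_of_mem _ (gen_mem_component D g)
  | add a b ha hb => rw [map_add]; exact add_mem ha hb
  | mul a b ha hb =>
    rw [map_mul]
    refine Submodule.iSup_induction (component D 1) (motive := fun x => x * _ ∈ _) ha ?_ (by simp)
      fun x y hx hy => by rw [add_mul]; exact add_mem hx hy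
    intro c x hx
    refine Submodule.iSup_induction (component D 1) (motive := fun y => x * y ∈ _) hb ?_ (by simp)
      fun x y hx hy => by rw [mul_add]; exact add_mem hx hy
    intro d y hy
    exact Submodule.mem_iSup_of_mem _ (mul_mem_component hx hy)

/-! #### The component of degree zero -/

/-- The product of the `X i` for `i` in a list. -/
def wordX (l : List I) : D.Construction 1 := (l.map fun i => gen D 1 (.X i)).prod

/-- The product of the `Y i` for `i` in a list. -/
def wordY (l : List I) : D.Construction 1 := (l.map fun i => gen D 1 (.Y i)).prod

@[simp] theorem wordX_nil : wordX D [] = 1 := rfl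

@[simp] theorem wordY_nil : wordY D [] = 1 := rfl

@[simp] theorem wordX_cons (i : I) (l : List I) :
    wordX D (i :: l) = gen D 1 (.X i) * wordX D l := by simp [wordX]

@[simp] theorem wordY_cons (i : I) (l : List I) :
    wordY D (i :: l) = gen D 1 (.Y i) * wordY D l := by simp [wordY]

theorem wordX_append (l l' : List I) : wordX D (l ++ l') = wordX D l * wordX D l' := by
  simp [wordX]

theorem wordY_append (l l' : List I) : wordY D (l ++ l') = wordY D l * wordY D l' := by
  simp [wordY]

theorem commute_X_wordY {i : I} {l : List I} (h : i ∉ l) :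
    Commute (gen D 1 (.X i)) (wordY D l) := by
  induction l with
  | nil => simp
  | cons j l ih =>
    rw [List.mem_cons, not_or] at h
    rw [wordY_cons]
    exact (gen_X_Y_comm D h.1).mul_right (ih h.2)

theorem commute_Y_wordX {i : I} {l : List I} (h : i ∉ l) :
    Commute (gen D 1 (.Y i)) (wordX D l) := by
  induction l with
  | nil => simp
  | cons j l ih =>
    rw [List.mem_cons, not_or] at h
    rw [wordX_cons]
    exact (gen_X_Y_comm D (Ne.symm h.1)).symm.mul_right (ih h.2)

theorem commute_wordX_wordY {l l' : List I} (h : l.Disjoint l') :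
    Commute (wordX D l) (wordY D l') := by
  induction l with
  | nil => simp
  | cons j l ih =>
    rw [List.disjoint_cons_left] at h
    rw [wordX_cons]
    exact (commute_X_wordY D h.1).mul_left (ih h.2)

theorem wordX_mul_coeff (l : List I) (r : R) :
    ∃ s, wordX D l * gen D 1 (.coeff r) = gen D 1 (.coeff s) * wordX D l := by
  induction l generalizing r with
  | nil => exact ⟨r, by simp⟩
  | cons j l ih =>
    obtain ⟨s, hs⟩ := ih r
    exact ⟨D.σ j s, by rw [wordX_cons, mul_assoc, hs, ← mul_assoc, gen_X_coeff, mul_assoc]⟩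

theorem wordY_mul_coeff (l : List I) (r : R) :
    ∃ s, wordY D l * gen D 1 (.coeff r) = gen D 1 (.coeff s) * wordY D l := by
  induction l generalizing r with
  | nil => exact ⟨r, by simp⟩
  | cons j l ih =>
    obtain ⟨s, hs⟩ := ih r
    exact ⟨(D.σ j).symm s, by rw [wordY_cons, mul_assoc, hs, ← mul_assoc, gen_Y_coeff, mul_assoc]⟩

/-- Every word can be written as `r Y_{j₁} ⋯ Y_{jₗ} X_{i₁} ⋯ X_{iₖ}` where no index occurs among
both the `i`'s and the `j`'s. -/
theorem exists_normal_form (w : List (TGWGen R I)) :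
    ∃ (r : R) (J L : List I), J.Disjoint L ∧
      (w.map (gen D 1)).prod = gen D 1 (.coeff r) * (wordY D J * wordX D L) ∧
      (w.map TGWGen.deg).sum + (J.map fun i => Finsupp.single i (1 : ℤ)).sum =
        (L.map fun i => Finsupp.single i (1 : ℤ)).sum := by
  induction w with
  | nil => exact ⟨1, [], [], by simp, by simp [gen_coeff_one], by simp⟩
  | cons g w ih =>
    obtain ⟨r, J, L, hJL, hw, hd⟩ := ih
    rw [List.map_cons, List.prod_cons, List.map_cons, List.sum_cons, hw]
    cases g with
    | coeff s =>
      exact ⟨s * r, J, L, hJL, by rw [gen_coeff_mul, mul_assoc], by simpa [TGWGen.deg] using hd⟩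
    | X i =>
      by_cases hi : i ∈ J
      -- Split at the first occurrence of `i`: `X i` commutes past `J₁`, collapses with `Y i` to
      -- `σ_i(t_i)`, and this coefficient moves back to the left. The `Y`'s are never permuted among
      -- themselves.
      · obtain ⟨J₁, J₂, rfl, hi₁⟩ := List.eq_append_cons_of_mem hi
        obtain ⟨s, hs⟩ := wordY_mul_coeff D J₁ (D.σ i (D.t i))
        refine ⟨D.σ i r * s, J₁ ++ J₂, L, fun a h₁ h₂ => hJL (by simp at h₁ ⊢; tauto) h₂, ?_, ?_⟩
        · rw [← mul_assoc, gen_X_coeff, mul_assoc, gen_coeff_mul, mul_assoc]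
          congr 1
          rw [← mul_assoc, ← mul_assoc]
          congr 1
          rw [wordY_append, wordY_cons, ← mul_assoc, (commute_X_wordY D hi₁).eq, mul_assoc,
            ← mul_assoc (gen D 1 (.X i)), gen_X_Y, ← mul_assoc, hs, mul_assoc, wordY_append]
        · rw [← hd]
          simp only [TGWGen.deg, List.map_append, List.sum_append, List.map_cons, List.sum_cons]
          abel
      · refine ⟨D.σ i r, J, i :: L, List.disjoint_cons_right.2 ⟨hi, hJL⟩, ?_, ?_⟩
        · rw [← mul_assoc, gen_X_coeff, mul_assoc, ← mul_assoc (gen D 1 (.X i)),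
            (commute_X_wordY D hi).eq, mul_assoc, wordX_cons]
        · rw [List.map_cons, List.sum_cons, ← hd, TGWGen.deg, add_assoc]
    | Y i =>
      by_cases hi : i ∈ L
      · obtain ⟨L₁, L₂, rfl, hi₁⟩ := List.eq_append_cons_of_mem hi
        obtain ⟨s, hs⟩ := wordX_mul_coeff D L₁ (D.t i)
        have hJ : (L₁ ++ L₂).Disjoint J := fun a h₁ h₂ => hJL h₂ (by simp at h₁ ⊢; tauto)
        refine ⟨(D.σ i).symm r * s, J, L₁ ++ L₂, hJ.symm, ?_, ?_⟩
        · rw [← mul_assoc, gen_Y_coeff, mul_assoc, gen_coeff_mul, mul_assoc]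
          congr 1
          -- The mirror image of the case of `X i` requires the `X`'s on the left, which
          -- disjointness permits.
          rw [← (commute_wordX_wordY D hJL.symm).eq, ← (commute_wordX_wordY D hJ).eq, ← mul_assoc,
            ← mul_assoc]
          congr 1
          rw [wordX_append, wordX_cons, ← mul_assoc, (commute_Y_wordX D hi₁).eq, mul_assoc,
            ← mul_assoc (gen D 1 (.Y i)), gen_Y_X, ← mul_assoc, hs, mul_assoc, wordX_append]
        · have hd' := congrArg (· - Finsupp.single i (1 : ℤ)) hd
          simp only [TGWGen.deg, List.map_append, List.sum_append, List.map_cons,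
            List.sum_cons] at hd' ⊢
          rw [neg_add_eq_sub, sub_add_eq_add_sub, hd']
          abel
      · refine ⟨(D.σ i).symm r, i :: J, L, List.disjoint_cons_left.2 ⟨hi, hJL⟩, ?_, ?_⟩
        · rw [← mul_assoc, gen_Y_coeff, mul_assoc, wordY_cons, mul_assoc]
        · rw [← hd, TGWGen.deg, List.map_cons, List.sum_cons]
          abel

theorem sum_map_single_apply [DecidableEq I] (l : List I) (i : I) :
    (l.map fun j => Finsupp.single j (1 : ℤ)).sum i = l.count i := by
  induction l with
  | nil => simp
  | cons j l ih =>
    rw [List.map_cons, List.sum_cons, Finsupp.add_apply, ih, List.count_cons, Finsupp.single_apply]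
    simp [add_comm]

/-- The component of degree zero is the image of `R`. -/
theorem exists_coeff_of_mem_component_zero {a : D.Construction 1} (ha : a ∈ component D 1 0) :
    ∃ r, a = gen D 1 (.coeff r) := by
  classical
  suffices h : component D 1 0 ≤ LinearMap.range (coeffHom D).toLinearMap by
    obtain ⟨r, hr⟩ := h ha
    exact ⟨r, hr.symm⟩
  refine Submodule.span_le.2 ?_
  rintro _ ⟨w, hw, rfl⟩
  obtain ⟨r, J, L, hJL, h, hd⟩ := exists_normal_form D w
  rw [hw, zero_add] at hd
  have hcount : ∀ i, J.count i = L.count i := fun i => by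
    have := DFunLike.congr_fun hd i
    rw [sum_map_single_apply, sum_map_single_apply] at this
    exact_mod_cast this
  have hJ : J = [] := List.eq_nil_iff_forall_not_mem.2 fun i hi =>
    hJL hi (List.count_pos_iff.1 (hcount i ▸ List.count_pos_iff.2 hi))
  have hL : L = [] := List.eq_nil_iff_forall_not_mem.2 fun i hi =>
    hJL (List.count_pos_iff.1 (hcount i ▸ List.count_pos_iff.2 hi)) hi
  exact ⟨r, by simp [h, hJ, hL, coeffHom_apply]⟩

/-- Every degree is the degree of a word in the generators `X i`, `Y i`. -/
theorem exists_word {R I : Type*} (d : I →₀ ℤ) : ∃ w : List (TGWGen R I), (w.map TGWGen.deg).sum = d ∧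
    ∀ g ∈ w, ∃ i, g = .X i ∨ g = .Y i := by
  induction d using Finsupp.induction_linear with
  | zero => exact ⟨[], by simp, by simp⟩
  | add c d hc hd =>
    obtain ⟨w, hw, h⟩ := hc
    obtain ⟨w', hw', h'⟩ := hd
    refine ⟨w ++ w', by simp [hw, hw'], fun g hg => ?_⟩
    rcases List.mem_append.1 hg with hg | hg
    exacts [h g hg, h' g hg]
  | single i n =>
    obtain ⟨n, rfl | rfl⟩ := n.eq_nat_or_neg
    · refine ⟨List.replicate n (.X i), by simp [TGWGen.deg], fun g hg => ⟨i, ?_⟩⟩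
      exact .inl (List.eq_of_mem_replicate hg)
    · refine ⟨List.replicate n (.Y i), by simp [TGWGen.deg], fun g hg => ⟨i, ?_⟩⟩
      exact .inr (List.eq_of_mem_replicate hg)

end Construction

/-! ### Regular representations and the radical -/

namespace IsRep

open Construction

variable {D : TGWDatum K R I} {B : Type*} [Ring B] [Algebra K B] {f : R →ₐ[K] B} {x y : I → B}

/-- Twisting a representation by the degree. -/
theorem graded (h : D.IsRep f x y) :
    D.IsRep ((AddMonoidAlgebra.singleZeroAlgHom : B →ₐ[K] AddMonoidAlgebra B (I →₀ ℤ)).comp f)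
      (fun i => AddMonoidAlgebra.single (Finsupp.single i 1) (x i))
      (fun i => AddMonoidAlgebra.single (-Finsupp.single i 1) (y i)) where
  x_coeff i r := by simp [AddMonoidAlgebra.single_mul_single, h.x_coeff]
  y_coeff i r := by simp [AddMonoidAlgebra.single_mul_single, h.y_coeff]
  y_x i := by simp [AddMonoidAlgebra.single_mul_single, h.y_x]
  x_y i := by simp [AddMonoidAlgebra.single_mul_single, h.x_y]
  x_y_comm i j hij := by simp [AddMonoidAlgebra.single_mul_single, h.x_y_comm i j hij, add_comm]

theorem lift_graded_gen (h : D.IsRep f x y) (g : TGWGen R I) :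
    lift h.graded (gen D 1 g) = AddMonoidAlgebra.single g.deg (lift h (gen D 1 g)) := by
  cases g <;> simp [genVal, TGWGen.deg]

theorem lift_graded_of_mem (h : D.IsRep f x y) {d : I →₀ ℤ} {a : D.Construction 1}
    (ha : a ∈ component D 1 d) :
    lift h.graded a = AddMonoidAlgebra.single d (lift h a) := by
  induction ha using Submodule.span_induction with
  | zero => simp
  | add a b _ _ ha hb => rw [map_add, map_add, ha, hb, AddMonoidAlgebra.single_add]
  | smul k a _ ha => rw [map_smul, map_smul, ha, AddMonoidAlgebra.smul_single]
  | mem a ha =>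
    obtain ⟨w, rfl, rfl⟩ := ha
    induction w with
    | nil => simp [AddMonoidAlgebra.one_def]
    | cons g w ih =>
      simp only [List.map_cons, List.prod_cons, List.sum_cons, map_mul] at ih ⊢
      rw [ih, lift_graded_gen, AddMonoidAlgebra.single_mul_single]

/-- A representation is regular if it is faithful on `R` and the `X i`, `Y i` act by left regular
elements. -/
structure Regular (h : D.IsRep f x y) : Prop where
  inj : Function.Injective f
  x_reg : ∀ i, IsLeftRegular (x i)
  y_reg : ∀ i, IsLeftRegular (y i)

/-- In every degree there is a word acting by a left regular element. -/
theorem Regular.exists_mem_component {h : D.IsRep f x y} (hr : h.Regular) (d : I →₀ ℤ) :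
    ∃ a ∈ component D 1 d, IsLeftRegular (lift h a) := by
  obtain ⟨w, rfl, hw⟩ := exists_word (R := R) d
  refine ⟨_, word_mem_component D w, ?_⟩
  induction w with
  | nil => simpa using isRegular_one.left
  | cons g w ih =>
    rw [List.map_cons, List.prod_cons, map_mul]
    refine IsLeftRegular.mul ?_ (ih fun g hg => hw g (List.mem_cons_of_mem _ hg))
    obtain ⟨i, rfl | rfl⟩ := hw g (List.mem_cons_self ..)
    · simpa [genVal] using hr.x_reg i
    · simpa [genVal] using hr.y_reg i

/-- A homogeneous `b` of degree `d` in an admissible ideal satisfies `c * b = 0` for every `c` of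
degree `-d`, since the product has degree zero; a `c` acting regularly forces `b` to act by zero.
Conversely the kernel is itself admissible: it is graded because degrees are recorded in the target,
and it meets the image of `R` trivially because `f` is injective. -/
theorem Regular.radicalIdeal_eq {h : D.IsRep f x y} (hr : h.Regular) :
    D.radicalIdeal 1 = RingHom.ker (lift h.graded) := by
  apply le_antisymm
  · refine sSup_le ?_
    rintro J ⟨hJ, hgr, hJ0⟩ a ha
    suffices H : Submodule.span K {b | b ∈ J ∧ ∃ d, b ∈ component D 1 d} ≤
        LinearMap.ker (lift h.graded).toLinearMap from H (hgr a ha)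
    refine Submodule.span_le.2 ?_
    rintro b ⟨hb, d, hd⟩
    obtain ⟨c, hc, hreg⟩ := hr.exists_mem_component (-d)
    have hcb : c * b = 0 := hJ0 _ (J.mul_mem_left c hb) (by simpa using mul_mem_component hc hd)
    have : lift h b = 0 := hreg (by simpa using congrArg (lift h) hcb)
    change lift h.graded b = 0
    rw [h.lift_graded_of_mem hd, this, AddMonoidAlgebra.single_zero]
  · refine le_sSup ⟨inferInstance, ?_, ?_⟩
    · intro a ha
      have ha' : a ∈ ⨆ d, component D 1 d := iSup_component D ▸ Submodule.mem_top
      obtain ⟨g, hg, rfl⟩ := (Submodule.mem_iSup_iff_exists_finsupp _ _).1 ha'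
      refine Submodule.sum_mem _ fun d _ => Submodule.subset_span ⟨?_, d, hg d⟩
      have h0 : ∑ c ∈ g.support, AddMonoidAlgebra.single c (lift h (g c)) = 0 := by
        rw [← (RingHom.mem_ker.1 ha : lift h.graded _ = 0), Finsupp.sum, map_sum]
        exact Finset.sum_congr rfl fun c _ => (h.lift_graded_of_mem (hg c)).symm
      change lift h.graded (g d) = 0
      rw [h.lift_graded_of_mem (hg d), AddMonoidAlgebra.single_eq_zero]
      -- Reading off the coefficient at `d` isolates the component `g d`. The sum runs over the
      -- support of `g`, so the case `g d = 0` is separate.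
      have h1 := congrArg (fun p => AddMonoidAlgebra.coeff p d) h0
      classical
      simp only [AddMonoidAlgebra.coeff_sum, AddMonoidAlgebra.coeff_single, Finsupp.coe_finsetSum,
        Finset.sum_apply, Finsupp.single_apply, Finset.sum_ite_eq', AddMonoidAlgebra.coeff_zero,
        Finsupp.coe_zero, Pi.zero_apply, Finsupp.mem_support_iff, ite_not] at h1
      by_cases hgd : g d = 0
      · rw [hgd, map_zero]
      · simpa [hgd] using h1
    · intro a ha h0
      obtain ⟨r, rfl⟩ := exists_coeff_of_mem_component_zero D h0
      have := (RingHom.mem_ker.1 ha : lift h.graded _ = 0)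
      rw [h.lift_graded_gen, AddMonoidAlgebra.single_eq_zero, lift_gen] at this
      have hr0 : r = 0 := hr.inj (by simpa [genVal] using this)
      rw [hr0, ← coeffHom_apply, map_zero]

/-- The homomorphism from the twisted generalized Weyl algebra that records degrees. -/
def Regular.gradedHom {h : D.IsRep f x y} (hr : h.Regular) :
    D.TGWAlgebra 1 →ₐ[K] AddMonoidAlgebra B (I →₀ ℤ) :=
  Ideal.Quotient.liftₐ _ (lift h.graded) fun a ha => by
    rw [hr.radicalIdeal_eq] at ha
    exact ha

theorem Regular.gradedHom_mk {h : D.IsRep f x y} (hr : h.Regular) (a : D.Construction 1) :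
    hr.gradedHom (Ideal.Quotient.mk _ a) = lift h.graded a := rfl

theorem Regular.gradedHom_injective {h : D.IsRep f x y} (hr : h.Regular) :
    Function.Injective hr.gradedHom := by
  rw [injective_iff_map_eq_zero]
  intro a ha
  obtain ⟨a, rfl⟩ := Ideal.Quotient.mk_surjective a
  rw [Ideal.Quotient.eq_zero_iff_mem, hr.radicalIdeal_eq]
  exact ha

/-- Forgetting degrees. -/
def forgetDegree (K I B : Type*) [Field K] [Ring B] [Algebra K B] :
    AddMonoidAlgebra B (I →₀ ℤ) →ₐ[K] B :=
  AddMonoidAlgebra.liftNCAlgHom (AlgHom.id K B) 1 fun _ _ => Commute.one_right _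

@[simp]
theorem forgetDegree_single (d : I →₀ ℤ) (b : B) :
    forgetDegree K I B (AddMonoidAlgebra.single d b) = b := by
  simp [forgetDegree]

theorem forgetDegree_eq_sum (p : AddMonoidAlgebra B (I →₀ ℤ)) :
    forgetDegree K I B p = p.coeff.sum fun _ b => b := by
  conv_lhs => rw [← AddMonoidAlgebra.sum_coeff_single p]
  simp [Finsupp.sum]

/-- The homomorphism from the twisted generalized Weyl algebra given by a regular representation. -/
def Regular.hom {h : D.IsRep f x y} (hr : h.Regular) : D.TGWAlgebra 1 →ₐ[K] B :=
  (forgetDegree K I B).comp hr.gradedHom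

theorem Regular.hom_mk {h : D.IsRep f x y} (hr : h.Regular) (a : D.Construction 1) :
    hr.hom (Ideal.Quotient.mk _ a) = lift h a := by
  have : (forgetDegree K I B).comp (lift h.graded) = lift h :=
    hom_ext fun g => by
      rw [AlgHom.comp_apply, lift_graded_gen, forgetDegree_single]
  exact DFunLike.congr_fun this a

end IsRep

end TGWDatum

end

noncomputable section

/-! ### Translations of polynomial rings -/

namespace MvPolynomial

variable {K E : Type*} [Field K]

/-- The translation `u_e ↦ u_e - k_e`. -/
def shift (k : E →₀ ℤ) : MvPolynomial E K →ₐ[K] MvPolynomial E K :=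
  aeval fun e => X e - C (k e : K)

@[simp]
theorem shift_X (k : E →₀ ℤ) (e : E) : shift k (X e : MvPolynomial E K) = X e - C (k e : K) := by
  simp [shift]

@[simp]
theorem shift_C (k : E →₀ ℤ) (c : K) : shift k (C c : MvPolynomial E K) = C c := by
  simp [shift]

theorem shift_shift (k l : E →₀ ℤ) (f : MvPolynomial E K) :
    shift k (shift l f) = shift (k + l) f := by
  have : (shift k).comp (shift l) = (shift (k + l) : MvPolynomial E K →ₐ[K] _) := by
    ext e : 1
    simp [sub_sub]
  exact DFunLike.congr_fun this f

@[simp]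
theorem shift_zero (f : MvPolynomial E K) : shift 0 f = f := by
  have : shift 0 = AlgHom.id K (MvPolynomial E K) := by
    ext e : 1
    simp
  exact DFunLike.congr_fun this f

theorem shift_injective (k : E →₀ ℤ) :
    Function.Injective (shift k : MvPolynomial E K →ₐ[K] MvPolynomial E K) :=
  Function.LeftInverse.injective (g := shift (-k)) fun f => by simp [shift_shift]

/-- Dedekind's independence of multiplicative maps into a domain. Characteristic zero ensures that
different integer vectors give different translations, as seen on the variables. -/
theorem linearIndependent_shift [CharZero K] :
    LinearIndependent (MvPolynomial E K)
      fun (k : E →₀ ℤ) (f : MvPolynomial E K) => shift k f := by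
  refine (linearIndependent_monoidHom (MvPolynomial E K) (MvPolynomial E K)).comp
    (fun k : E →₀ ℤ => ((shift k : MvPolynomial E K →ₐ[K] MvPolynomial E K) :
      MvPolynomial E K →* MvPolynomial E K)) fun k l hkl => ?_
  ext e
  have := DFunLike.congr_fun hkl (X e)
  simpa using this

/-- The rising factorial `u_e (u_e + 1) ⋯ (u_e + n - 1)`. -/
def rising (K : Type*) [Field K] (e : E) (n : ℕ) : MvPolynomial E K :=
  ∏ i ∈ Finset.range n, (X e + C (i : K))

@[simp]
theorem rising_zero (e : E) : rising K e 0 = 1 := by simp [rising]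

theorem rising_ne_zero (e : E) (n : ℕ) : rising K e n ≠ 0 :=
  Finset.prod_ne_zero_iff.2 fun _ _ => Multiquiver.X_add_C_ne_zero K e _

theorem rising_succ (e : E) (n : ℕ) : rising K e (n + 1) = rising K e n * (X e + C (n : K)) := by
  rw [rising, Finset.prod_range_succ, ← rising]

theorem shift_rising (k : E →₀ ℤ) (e : E) (n : ℕ) :
    shift k (rising K e n) = ∏ i ∈ Finset.range n, (X e - C (k e : K) + C (i : K)) := by
  simp [rising, map_prod]

/-- The coefficient of the difference operator that represents `z^k`. -/
def zCoeff (K : Type*) [Field K] (k : E →₀ ℤ) : MvPolynomial E K :=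
  k.prod fun e p => rising K e (-p).toNat

theorem zCoeff_ne_zero (k : E →₀ ℤ) : zCoeff K k ≠ 0 :=
  Finset.prod_ne_zero_iff.2 fun _ _ => rising_ne_zero _ _

/-- Allows coefficients for different `k` to be compared edge by edge over a common set. -/
theorem zCoeff_eq_prod {k : E →₀ ℤ} {S : Finset E} (h : k.support ⊆ S) :
    zCoeff K k = ∏ e ∈ S, rising K e (-k e).toNat :=
  Finsupp.prod_of_support_subset k h _ (by simp)

end MvPolynomial

/-! ### The Weyl algebra as an algebra of difference operators -/

namespace WeylAlgebra

open MvPolynomial (shift shift_shift rising zCoeff)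

variable (K : Type*) {E : Type*} [Field K]

theorem x_comm (e f : E) : Commute (x K e) (x K f) := by
  simpa [x, Commute, SemiconjBy] using RingQuot.mkAlgHom_rel K (WeylRel.x_x (K := K) e f)

theorem y_comm (e f : E) : Commute (y K e) (y K f) := by
  simpa [y, Commute, SemiconjBy] using RingQuot.mkAlgHom_rel K (WeylRel.y_y (K := K) e f)

theorem y_x_comm {e f : E} (h : e ≠ f) : Commute (y K e) (x K f) := by
  simpa [x, y, Commute, SemiconjBy, h] using RingQuot.mkAlgHom_rel K (WeylRel.y_x (K := K) e f)

theorem y_mul_x (e : E) : y K e * x K e = x K e * y K e + 1 := by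
  simpa [x, y] using RingQuot.mkAlgHom_rel K (WeylRel.y_x (K := K) e e)

theorem y_x_pair_comm (e f : E) : Commute (y K e * x K e) (y K f * x K f) := by
  by_cases h : e = f
  · rw [h]
  · exact ((y_comm K e f).mul_right (y_x_comm K h)).mul_left
      ((y_x_comm K (Ne.symm h)).symm.mul_right (x_comm K e f))

variable (E) in
-- Evaluation of commutative polynomials needs a commutative target, so `polyHom` is routed through
-- the subalgebra generated by the pairwise commuting `y_e x_e`.
theorem isMulCommutative_adjoin_y_x :
    IsMulCommutative (Algebra.adjoin K (Set.range fun e : E => y K e * x K e)) :=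
  Algebra.isMulCommutative_adjoin K (by
    rintro _ ⟨e, rfl⟩ _ ⟨f, rfl⟩
    exact y_x_pair_comm K e f)

open scoped IsMulCommutative in
variable (E) in
/-- The homomorphism `K[u_e | e ∈ E] → A_E(K)`, `u_e ↦ y_e x_e`. -/
def polyHom : MvPolynomial E K →ₐ[K] WeylAlgebra K E :=
  haveI := isMulCommutative_adjoin_y_x K E
  (Algebra.adjoin K (Set.range fun e : E => y K e * x K e)).val.comp
    (MvPolynomial.aeval (S₁ := Algebra.adjoin K (Set.range fun e : E => y K e * x K e))
      fun e => ⟨y K e * x K e, Algebra.subset_adjoin ⟨e, rfl⟩⟩)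

@[simp]
theorem polyHom_X (e : E) : polyHom K E (MvPolynomial.X e) = y K e * x K e := by
  simp [polyHom]

@[simp]
theorem polyHom_C (c : K) : polyHom K E (MvPolynomial.C c) = algebraMap K _ c :=
  (polyHom K E).commutes c

/-- The case `r = u_e` is `x(yx) = (xy)x = (yx - 1)x`; the other variables commute with `x_e`. -/
theorem x_mul_polyHom (e : E) (r : MvPolynomial E K) :
    x K e * polyHom K E r = polyHom K E (shift (Finsupp.single e 1) r) * x K e := by
  induction r using MvPolynomial.induction_on with
  | C c => simp [Algebra.commutes]
  | add p q hp hq => simp only [map_add, mul_add, add_mul, hp, hq]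
  | mul_X p f hp =>
    rw [map_mul, ← mul_assoc, hp, mul_assoc, map_mul, map_mul, mul_assoc]
    congr 1
    by_cases h : e = f
    · subst h
      simp [y_mul_x, mul_add, mul_assoc]
    · rw [polyHom_X, MvPolynomial.shift_X, Finsupp.single_eq_of_ne (Ne.symm h)]
      simpa using ((y_x_comm K (Ne.symm h)).symm.mul_right (x_comm K e f)).eq

theorem y_mul_polyHom (e : E) (r : MvPolynomial E K) :
    y K e * polyHom K E r = polyHom K E (shift (-Finsupp.single e 1) r) * y K e := by
  induction r using MvPolynomial.induction_on with
  | C c => simp [Algebra.commutes]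
  | add p q hp hq => simp only [map_add, mul_add, add_mul, hp, hq]
  | mul_X p f hp =>
    rw [map_mul, ← mul_assoc, hp, mul_assoc, map_mul, map_mul, mul_assoc]
    congr 1
    by_cases h : e = f
    · subst h
      have h' : y K e * (x K e * y K e) = x K e * (y K e * y K e) + y K e := by
        rw [← mul_assoc, y_mul_x, add_mul, one_mul, mul_assoc]
      simp [y_mul_x, mul_add, add_mul, mul_assoc, h']
    · rw [polyHom_X, MvPolynomial.shift_X, Finsupp.neg_apply, Finsupp.single_eq_of_ne (Ne.symm h)]
      simpa using ((y_comm K e f).mul_right (y_x_comm K h)).eq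

/-! #### The elements `z^k` -/

theorem zPow_natCast (e : E) (n : ℕ) : zPow K e n = x K e ^ n := by simp [zPow]

theorem zPow_neg_natCast (e : E) (n : ℕ) : zPow K e (-n) = y K e ^ n := by
  rcases n with _ | n
  · simp [zPow]
  · have h : ¬(0 : ℤ) ≤ -((n + 1 : ℕ) : ℤ) := by push_cast; lia
    simp only [zPow, h, if_false, neg_neg, Int.toNat_natCast]

@[simp] theorem zPow_zero (e : E) : zPow K e 0 = 1 := by simp [zPow]

@[simp] theorem z_zero : z K (0 : E →₀ ℤ) = 1 := by simp [z]

theorem z_eq_mul_erase (e : E) (k : E →₀ ℤ) : z K k = zPow K e (k e) * z K (k.erase e) := by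
  classical
  have herase : z K (k.erase e) = (k.support.erase e).noncommProd (fun f => zPow K f (k f))
      fun _ _ _ _ h => zPow_commute K h _ _ := by
    unfold z
    refine Finset.noncommProd_congr Finsupp.support_erase (fun f hf => ?_) _
    rw [Finsupp.erase_ne (Finset.ne_of_mem_erase hf)]
  rw [herase]
  by_cases he : e ∈ k.support
  · rw [← Finset.noncommProd_insert_of_notMem _ _ (fun f => zPow K f (k f))
      (fun _ _ _ _ h => zPow_commute K h _ _) (Finset.notMem_erase e _)]
    unfold z
    exact Finset.noncommProd_congr (Finset.insert_erase he).symm (fun _ _ => rfl) _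
  · rw [Finsupp.notMem_support_iff.1 he, zPow_zero, one_mul]
    unfold z
    exact Finset.noncommProd_congr (Finset.erase_eq_of_notMem he).symm (fun _ _ => rfl) _

theorem z_add_single (e : E) (k : E →₀ ℤ) (p : ℤ) :
    z K (k + Finsupp.single e p) = zPow K e (k e + p) * z K (k.erase e) := by
  rw [z_eq_mul_erase K e]
  congr 2
  · simp
  · simp

/-- For negative `p` one factor cancels through `xy = u - 1`. Together with the analogue for `y_e`,
where `yx = u`, this makes the sum of the `component`s stable under left multiplication. -/
theorem exists_x_mul_zPow (e : E) (p : ℤ) :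
    ∃ q, x K e * zPow K e p = polyHom K E q * zPow K e (p + 1) := by
  obtain ⟨n, rfl | rfl⟩ := p.eq_nat_or_neg
  · refine ⟨1, ?_⟩
    rw [map_one, one_mul, zPow_natCast, ← pow_succ', ← zPow_natCast]
    push_cast
    rfl
  · rcases n with _ | n
    · refine ⟨1, ?_⟩
      simpa using (zPow_natCast K e 1).symm
    · refine ⟨MvPolynomial.X e - 1, ?_⟩
      have : -((n + 1 : ℕ) : ℤ) + 1 = -(n : ℤ) := by push_cast; ring
      rw [this, zPow_neg_natCast, zPow_neg_natCast, pow_succ', ← mul_assoc]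
      simp [y_mul_x]

theorem exists_y_mul_zPow (e : E) (p : ℤ) :
    ∃ q, y K e * zPow K e p = polyHom K E q * zPow K e (p + -1) := by
  obtain ⟨n, rfl | rfl⟩ := p.eq_nat_or_neg
  · rcases n with _ | n
    · refine ⟨1, ?_⟩
      simpa using (zPow_neg_natCast K e 1).symm
    · refine ⟨MvPolynomial.X e, ?_⟩
      have : ((n + 1 : ℕ) : ℤ) + -1 = n := by push_cast; ring
      rw [this, zPow_natCast, zPow_natCast, pow_succ', ← mul_assoc, polyHom_X]
  · refine ⟨1, ?_⟩
    have : -(n : ℤ) + -1 = -((n + 1 : ℕ) : ℤ) := by push_cast; ring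
    rw [map_one, one_mul, this, zPow_neg_natCast, zPow_neg_natCast, pow_succ']

/-- The left `K[u]`-submodule generated by `z^k`. -/
def component (k : E →₀ ℤ) : Submodule K (WeylAlgebra K E) :=
  LinearMap.range ((LinearMap.mulRight K (z K k)).comp (polyHom K E).toLinearMap)

theorem mem_component {k : E →₀ ℤ} {a : WeylAlgebra K E} :
    a ∈ component K k ↔ ∃ r, polyHom K E r * z K k = a := by
  simp [component]

theorem x_mul_mem_component (e : E) {k : E →₀ ℤ} {a : WeylAlgebra K E} (ha : a ∈ component K k) :
    x K e * a ∈ component K (k + Finsupp.single e 1) := by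
  obtain ⟨r, rfl⟩ := (mem_component K).1 ha
  obtain ⟨q, hq⟩ := exists_x_mul_zPow K e (k e)
  refine (mem_component K).2 ⟨shift (Finsupp.single e 1) r * q, ?_⟩
  rw [z_add_single, ← mul_assoc (x K e), x_mul_polyHom, z_eq_mul_erase K e k, mul_assoc _ (x K e),
    ← mul_assoc (x K e), hq, map_mul]
  simp only [mul_assoc]

theorem y_mul_mem_component (e : E) {k : E →₀ ℤ} {a : WeylAlgebra K E} (ha : a ∈ component K k) :
    y K e * a ∈ component K (k + Finsupp.single e (-1)) := by
  obtain ⟨r, rfl⟩ := (mem_component K).1 ha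
  obtain ⟨q, hq⟩ := exists_y_mul_zPow K e (k e)
  refine (mem_component K).2 ⟨shift (-Finsupp.single e 1) r * q, ?_⟩
  rw [z_add_single, ← mul_assoc (y K e), y_mul_polyHom, z_eq_mul_erase K e k, mul_assoc _ (y K e),
    ← mul_assoc (y K e), hq, map_mul]
  simp only [mul_assoc]

variable (E) in
theorem iSup_component : ⨆ k : E →₀ ℤ, component K k = ⊤ := by
  -- The sum contains `1 = z^0`, so it suffices that it is a left ideal, which can be tested on
  -- generators.
  suffices h : ∀ a : WeylAlgebra K E, ∀ b ∈ ⨆ k, component K k, a * b ∈ ⨆ k, component K k by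
    rw [eq_top_iff]
    rintro a -
    simpa using h a 1 (Submodule.mem_iSup_of_mem 0 ((mem_component K).2 ⟨1, by simp⟩))
  intro a
  obtain ⟨a, rfl⟩ := RingQuot.mkAlgHom_surjective K (WeylRel K E) a
  induction a using FreeAlgebra.induction with
  | grade0 c =>
    intro b hb
    rw [AlgHom.commutes, ← Algebra.smul_def]
    exact Submodule.smul_mem _ _ hb
  | add a a' ha ha' =>
    intro b hb
    rw [map_add, add_mul]
    exact add_mem (ha b hb) (ha' b hb)
  | mul a a' ha ha' =>
    intro b hb
    rw [map_mul, mul_assoc]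
    exact ha _ (ha' b hb)
  | grade1 g =>
    intro b hb
    refine Submodule.iSup_induction (component K) (motive := fun b => _ * b ∈ _) hb ?_ (by simp)
      fun b c hb hc => by rw [mul_add]; exact add_mem hb hc
    intro k b hb
    cases g with
    | x e => exact Submodule.mem_iSup_of_mem _ (x_mul_mem_component K e hb)
    | y e => exact Submodule.mem_iSup_of_mem _ (y_mul_mem_component K e hb)

/-! #### The representation by difference operators -/

/-- The action of the generators on `K[u_e | e ∈ E]` by difference operators:
`x_e` acts by `u_e ↦ u_e - 1`, and `y_e` by `u_e ↦ u_e + 1` followed by multiplication by `u_e`. -/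
def diffGen : WeylGen E → Module.End K (MvPolynomial E K)
  | .x e => (shift (Finsupp.single e 1)).toLinearMap
  | .y e => (LinearMap.mulLeft K (MvPolynomial.X e)).comp
      (shift (-Finsupp.single e 1)).toLinearMap

variable (E) in
/-- The representation of the Weyl algebra by difference operators. -/
def diffRep : WeylAlgebra K E →ₐ[K] Module.End K (MvPolynomial E K) :=
  RingQuot.liftAlgHom K ⟨FreeAlgebra.lift K (diffGen K), by
    classical
    intro a b hab
    induction hab with
    | x_x e f =>
      refine LinearMap.ext fun p => ?_
      simp [diffGen, shift_shift, add_comm]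
    | y_y e f =>
      refine LinearMap.ext fun p => ?_
      by_cases h : e = f
      · rw [h]
      · simp [diffGen, shift_shift, h, Ne.symm h, mul_left_comm, add_comm]
    | y_x e f =>
      refine LinearMap.ext fun p => ?_
      by_cases h : e = f
      · subst h
        simp [diffGen, shift_shift]
        ring
      · simp [diffGen, shift_shift, h, add_comm]⟩

@[simp]
theorem diffRep_x (e : E) (f : MvPolynomial E K) :
    diffRep K E (x K e) f = shift (Finsupp.single e 1) f := by
  simp [diffRep, x, diffGen]

@[simp]
theorem diffRep_y (e : E) (f : MvPolynomial E K) :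
    diffRep K E (y K e) f = MvPolynomial.X e * shift (-Finsupp.single e 1) f := by
  simp [diffRep, y, diffGen]

@[simp]
theorem diffRep_polyHom (r f : MvPolynomial E K) : diffRep K E (polyHom K E r) f = r * f := by
  have : (diffRep K E).comp (polyHom K E) = Algebra.lmul K (MvPolynomial E K) := by
    ext e : 1
    refine LinearMap.ext fun p => ?_
    simp [shift_shift]
  exact LinearMap.congr_fun (DFunLike.congr_fun this r) f

theorem diffRep_x_pow (e : E) (n : ℕ) (f : MvPolynomial E K) :
    diffRep K E (x K e ^ n) f = shift (Finsupp.single e n) f := by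
  induction n generalizing f with
  | zero => simp
  | succ n ih =>
    rw [pow_succ, map_mul, Module.End.mul_apply, diffRep_x, ih, shift_shift, ← Finsupp.single_add]
    push_cast
    rfl

theorem diffRep_y_pow (e : E) (n : ℕ) (f : MvPolynomial E K) :
    diffRep K E (y K e ^ n) f = rising K e n * shift (Finsupp.single e (-n)) f := by
  induction n generalizing f with
  | zero => simp
  | succ n ih =>
    rw [pow_succ, map_mul, Module.End.mul_apply, diffRep_y, ih, map_mul, shift_shift,
      ← Finsupp.single_neg, ← Finsupp.single_add, MvPolynomial.rising_succ, mul_assoc]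
    congr 2
    · simp
    · congr 3
      push_cast
      ring

theorem diffRep_zPow (e : E) (p : ℤ) (f : MvPolynomial E K) :
    diffRep K E (zPow K e p) f = rising K e (-p).toNat * shift (Finsupp.single e p) f := by
  obtain ⟨n, rfl | rfl⟩ := p.eq_nat_or_neg
  · rw [zPow_natCast, diffRep_x_pow]
    simp
  · rw [zPow_neg_natCast, diffRep_y_pow]
    simp

/-- Factors for different edges do not interact: translating `u_e` leaves the rising factorials in
the other variables unchanged. -/
theorem diffRep_z (k : E →₀ ℤ) (f : MvPolynomial E K) :
    diffRep K E (z K k) f = zCoeff K k * shift k f := by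
  induction k using Finsupp.induction generalizing f with
  | zero => simp [zCoeff]
  | single_add e p k he hp ih =>
    rw [add_comm, z_add_single, Finsupp.erase_of_notMem_support he, Finsupp.notMem_support_iff.1 he,
      zero_add, map_mul, Module.End.mul_apply, ih, diffRep_zPow, map_mul, shift_shift, ← mul_assoc,
      add_comm k]
    congr 1
    rw [zCoeff, zCoeff, Finsupp.prod_add_index_of_disjoint, Finsupp.prod_single_index (by simp)]
    · congr 1
      rw [Finsupp.prod, map_prod]
      refine Finset.prod_congr rfl fun f hf => ?_
      have hfe : e ≠ f := fun h => he (h ▸ hf)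
      rw [MvPolynomial.shift_rising, Finsupp.single_eq_of_ne hfe.symm]
      simp [rising]
    · refine Finset.disjoint_left.2 fun f hf hk => he ?_
      rwa [Finset.mem_singleton.1 (Finsupp.support_single_subset hf)] at hk

variable (E) in
-- Write an element as a finite sum of `r_k z^k`. It acts as the combination of translations with
-- coefficients `r_k * zCoeff K k`; independence makes these vanish, and `zCoeff K k` is nonzero in
-- a domain.
theorem diffRep_injective [CharZero K] : Function.Injective (diffRep K E) := by
  rw [injective_iff_map_eq_zero]
  intro a ha
  have ha' : a ∈ ⨆ k : E →₀ ℤ, component K k := iSup_component K E ▸ Submodule.mem_top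
  obtain ⟨g, hg, rfl⟩ := (Submodule.mem_iSup_iff_exists_finsupp _ _).1 ha'
  choose r hr using fun k => (mem_component K).1 (hg k)
  have hsum : ∑ k ∈ g.support, (r k * zCoeff K k) •
      (fun f : MvPolynomial E K => (shift k f : MvPolynomial E K)) = 0 := by
    funext f
    have := LinearMap.congr_fun ha f
    rw [Finsupp.sum, map_sum, LinearMap.sum_apply] at this
    rw [Finset.sum_apply, Pi.zero_apply]
    rw [LinearMap.zero_apply] at this
    rw [← this]
    refine Finset.sum_congr rfl fun k _ => ?_
    rw [← hr k, map_mul, Module.End.mul_apply, diffRep_z, diffRep_polyHom, Pi.smul_apply,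
      smul_eq_mul, mul_assoc]
  have h0 := linearIndependent_iff'.1 (MvPolynomial.linearIndependent_shift (K := K) (E := E))
    g.support _ hsum
  refine Finset.sum_eq_zero fun k hk => ?_
  have : r k = 0 := (mul_eq_zero.1 (h0 k hk)).resolve_right (MvPolynomial.zCoeff_ne_zero k)
  simp only [← hr k, this, map_zero, zero_mul]

variable (E) in
theorem polyHom_injective : Function.Injective (polyHom K E) := fun r s h => by
  have := LinearMap.congr_fun (congrArg (diffRep K E) h) 1
  simpa using this

/-- In the faithful representation `z^k` is an injective operator: a translation followed by
multiplication by a nonzero polynomial. -/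
theorem isLeftRegular_z [CharZero K] (k : E →₀ ℤ) : IsLeftRegular (z K k) := by
  intro a b hab
  refine diffRep_injective K E (LinearMap.ext fun f => ?_)
  have := LinearMap.congr_fun (congrArg (diffRep K E) hab) f
  simp only [map_mul, Module.End.mul_apply, diffRep_z] at this
  exact MvPolynomial.shift_injective k
    (mul_left_cancel₀ (MvPolynomial.zCoeff_ne_zero k) this)

theorem z_mul_polyHom [CharZero K] (k : E →₀ ℤ) (r : MvPolynomial E K) :
    z K k * polyHom K E r = polyHom K E (shift k r) * z K k := by
  refine diffRep_injective K E (LinearMap.ext fun f => ?_)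
  simp only [map_mul, Module.End.mul_apply, diffRep_z, diffRep_polyHom]
  ring

theorem z_mul_z_eq_polyHom [CharZero K] (k : E →₀ ℤ) :
    z K (-k) * z K k = polyHom K E (zCoeff K (-k) * shift (-k) (zCoeff K k)) := by
  refine diffRep_injective K E (LinearMap.ext fun f => ?_)
  simp only [map_mul, Module.End.mul_apply, diffRep_z, diffRep_polyHom, shift_shift]
  simp

/-- Both products translate by `k + l`, so only the polynomial factors have to be compared. -/
theorem z_commute [CharZero K] {k l : E →₀ ℤ}
    (h : zCoeff K k * shift k (zCoeff K l) = zCoeff K l * shift l (zCoeff K k)) :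
    Commute (z K k) (z K l) := by
  refine diffRep_injective K E (LinearMap.ext fun f => ?_)
  simp only [map_mul, Module.End.mul_apply, diffRep_z, shift_shift, ← mul_assoc, h, add_comm]

end WeylAlgebra

end

noncomputable section

/-! ### Construction of the canonical representation -/

namespace Multiquiver

open MvPolynomial (shift shift_shift rising zCoeff)
open TGWDatum TGWDatum.Construction

variable {V E : Type*} (Γ : Multiquiver V E)

theorem multAt_t_eq_zero_or (e : E) (v : V) : multAt (Γ.t e) v = 0 ∨ multAt (Γ.s e) v = 0 := by
  by_contra! h
  obtain ⟨m, hm⟩ := multAt_ne_zero h.1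
  obtain ⟨n, hn⟩ := multAt_ne_zero h.2
  exact Γ.no_loops e v n v m hn hm rfl

theorem multAt_eq_zero_or (o : Option (V × ℕ+)) {v w : V} (h : v ≠ w) :
    multAt o v = 0 ∨ multAt o w = 0 := by
  by_contra! h'
  obtain ⟨m, hm⟩ := multAt_ne_zero h'.1
  obtain ⟨n, hn⟩ := multAt_ne_zero h'.2
  rw [hm] at hn
  simp only [Option.some.injEq, Prod.mk.injEq] at hn
  exact h hn.1

theorem column_apply (v : V) (e : E) : Γ.column v e = Γ.entry e v := rfl

theorem γ_single (v : V) : Γ.γ (Finsupp.single v 1) = Γ.column v := by simp [γ]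

theorem support_column_subset (v : V) :
    (Γ.column v).support ⊆ (Γ.finite_incident v).toFinset := by
  intro e he
  rw [Finsupp.mem_support_iff, column_apply, entry] at he
  rw [Set.Finite.mem_toFinset]
  by_cases h : multAt (Γ.t e) v = 0
  · exact .inl (multAt_ne_zero fun h' => he (by simp [h, h']))
  · exact .inr (multAt_ne_zero h)

variable (K : Type*) [Field K]

theorem σ_apply (v : V) (r : MvPolynomial E K) : Γ.σ K v r = shift (Γ.column v) r := rfl

theorem σ_symm_apply (v : V) (r : MvPolynomial E K) :
    (Γ.σ K v).symm r = shift (-Γ.column v) r := by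
  rw [AlgEquiv.symm_apply_eq, σ_apply, shift_shift]
  simp

/-- Each incident edge contributes through only one factor, as there are no loops: a target end
gives the rising factorial directly, while a source end of multiplicity `n` gives the rising
factorial translated to start at `u_e - n`. -/
theorem zCoeff_mul_shift_zCoeff_column (v : V) :
    zCoeff K (-Γ.column v) * shift (-Γ.column v) (zCoeff K (Γ.column v)) = Γ.tElt K v := by
  have h := Γ.support_column_subset v
  rw [MvPolynomial.zCoeff_eq_prod h,
    MvPolynomial.zCoeff_eq_prod (Finsupp.support_neg (Γ.column v) ▸ h), map_prod,
    ← Finset.prod_mul_distrib, tElt]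
  refine Finset.prod_congr rfl fun e _ => ?_
  rw [MvPolynomial.shift_rising, uEdge, rising, Finsupp.neg_apply, column_apply, entry]
  rcases Γ.multAt_t_eq_zero_or e v with h0 | h0
  · rw [h0]
    simp only [Nat.cast_zero, zero_sub, neg_neg, Int.toNat_neg_natCast, Finset.range_zero,
      Finset.prod_empty, one_mul, Int.toNat_natCast]
    -- The translated factorial lists its factors from `u_e - n` up to `u_e - 1`; `uEdge` lists them
    -- in the opposite order.
    rw [← Finset.prod_range_reflect]
    refine Finset.prod_congr rfl fun i hi => ?_
    rw [Finset.mem_range] at hi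
    rw [Nat.sub_sub, Nat.cast_sub (by lia)]
    simp only [Int.cast_natCast, map_natCast, Nat.cast_add, Nat.cast_one, map_sub, map_add, map_one]
    ring
  · rw [h0]
    simp

/-- Only an edge from `v` to `w` makes both coefficients nontrivial. With multiplicities `m` and
`n`, both sides there equal the rising factorial of length `m + n`, split in two ways. -/
theorem zCoeff_column_comm {v w : V} (h : v ≠ w) :
    zCoeff K (Γ.column v) * shift (Γ.column v) (zCoeff K (-Γ.column w)) =
      zCoeff K (-Γ.column w) * shift (-Γ.column w) (zCoeff K (Γ.column v)) := by
  classical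
  have hv : (Γ.column v).support ⊆ (Γ.column v).support ∪ (Γ.column w).support :=
    Finset.subset_union_left
  have hw : (-Γ.column w).support ⊆ (Γ.column v).support ∪ (Γ.column w).support := by
    rw [Finsupp.support_neg]
    exact Finset.subset_union_right
  rw [MvPolynomial.zCoeff_eq_prod hv, MvPolynomial.zCoeff_eq_prod hw, map_prod, map_prod,
    ← Finset.prod_mul_distrib, ← Finset.prod_mul_distrib]
  refine Finset.prod_congr rfl fun e _ => ?_
  rw [MvPolynomial.shift_rising, MvPolynomial.shift_rising, Finsupp.neg_apply, neg_neg,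
    column_apply, column_apply]
  obtain ⟨m, hm⟩ : ∃ m, m = (-Γ.entry e v).toNat := ⟨_, rfl⟩
  obtain ⟨n, hn⟩ : ∃ n, n = (Γ.entry e w).toNat := ⟨_, rfl⟩
  rw [← hm, ← hn]
  have h₁ := multAt_eq_zero_or (Γ.t e) h
  have h₂ := multAt_eq_zero_or (Γ.s e) h
  -- If `n ≠ 0` then `w` is the target of `e`, so `v` is not and its entry cannot be positive; the
  -- next line is the same argument at the source.
  have hm' : n = 0 ∨ Γ.entry e v = -m := by unfold entry at *; lia
  have hn' : m = 0 ∨ Γ.entry e w = n := by unfold entry at *; lia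
  rcases eq_or_ne n 0 with rfl | hn0
  · rcases hn' with rfl | hn'
    · simp
    · simp [hn', rising]
  · rw [hm'.resolve_left hn0]
    rcases hn' with rfl | hn'
    · simp [rising]
    · rw [hn']
      have h₃ : ∀ a b : ℕ, rising K e a * ∏ i ∈ Finset.range b,
          (MvPolynomial.X e + MvPolynomial.C (a : K) + MvPolynomial.C (i : K)) =
            rising K e (a + b) := by
        intro a b
        simp [rising, Finset.prod_range_add, add_assoc]
      have h₄ := h₃ m n
      rw [add_comm m n, ← h₃ n m] at h₄
      simpa using h₄

theorem ρ_eq_mk (r : MvPolynomial E K) :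
    Γ.ρ K r = Ideal.Quotient.mk _ (gen (Γ.datum K) 1 (.coeff r)) := rfl

variable {Γ K} in
theorem IsCanonicalRep.ext {φ ψ : Γ.Alg K →ₐ[K] WeylAlgebra K E} (hφ : Γ.IsCanonicalRep φ)
    (hψ : Γ.IsCanonicalRep ψ) : φ = ψ := by
  have hρ : φ.comp (Γ.ρ K) = ψ.comp (Γ.ρ K) := by
    ext e : 1
    exact (hφ.map_u e).trans (hψ.map_u e).symm
  have : φ.comp (Ideal.Quotient.mkₐ K _) = ψ.comp (Ideal.Quotient.mkₐ K _) :=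
    hom_ext fun g => by
      cases g with
      | coeff r => exact DFunLike.congr_fun hρ r
      | X v => exact (hφ.map_X v).trans (hψ.map_X v).symm
      | Y v => exact (hφ.map_Y v).trans (hψ.map_Y v).symm
  ext a
  obtain ⟨a, rfl⟩ := Ideal.Quotient.mk_surjective a
  exact DFunLike.congr_fun this a

variable [CharZero K]

/-- The canonical representation, on the level of the twisted generalized Weyl construction. -/
theorem isRep_z : (Γ.datum K).IsRep (WeylAlgebra.polyHom K E)
    (fun v => WeylAlgebra.z K (Γ.column v)) (fun v => WeylAlgebra.z K (-Γ.column v)) where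
  x_coeff v r := WeylAlgebra.z_mul_polyHom K _ r
  y_coeff v r := by
    rw [WeylAlgebra.z_mul_polyHom, ← σ_symm_apply]
    rfl
  y_x v := by
    rw [WeylAlgebra.z_mul_z_eq_polyHom, zCoeff_mul_shift_zCoeff_column]
    rfl
  x_y v := by
    have h := WeylAlgebra.z_mul_z_eq_polyHom K (-Γ.column v)
    rw [neg_neg] at h
    rw [h]
    change _ = WeylAlgebra.polyHom K E (shift (Γ.column v) (Γ.tElt K v))
    rw [← zCoeff_mul_shift_zCoeff_column, map_mul (shift _), shift_shift, add_neg_cancel,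
      MvPolynomial.shift_zero, mul_comm]
  x_y_comm v w h := WeylAlgebra.z_commute K (Γ.zCoeff_column_comm K h)

theorem isRep_z_regular : (Γ.isRep_z K).Regular where
  inj := WeylAlgebra.polyHom_injective K E
  x_reg _ := WeylAlgebra.isLeftRegular_z K _
  y_reg _ := WeylAlgebra.isLeftRegular_z K _

/-- The canonical representation of `A(Γ)` by differential operators. -/
def canonicalRep : Γ.Alg K →ₐ[K] WeylAlgebra K E := (Γ.isRep_z_regular K).hom

theorem canonicalRep_ρ (r : MvPolynomial E K) :
    Γ.canonicalRep K (Γ.ρ K r) = WeylAlgebra.polyHom K E r := by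
  rw [ρ_eq_mk, canonicalRep, IsRep.Regular.hom_mk, lift_gen, genVal]

theorem isCanonicalRep_canonicalRep : Γ.IsCanonicalRep (Γ.canonicalRep K) where
  map_X v := by
    rw [γ_single]
    exact (IsRep.Regular.hom_mk _ _).trans (lift_gen _ _)
  map_Y v := by
    rw [γ_single]
    exact (IsRep.Regular.hom_mk _ _).trans (lift_gen _ _)
  map_u e := by rw [canonicalRep_ρ, WeylAlgebra.polyHom_X]

/-! #### Homogeneous elements as difference operators -/

/-- Operators of the form polynomial times translation compose, with translations adding. The degree
is visible to the Weyl algebra only through its image under `γ`. -/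
theorem exists_diffRep_lift {d : V →₀ ℤ} {a : (Γ.datum K).Construction 1}
    (ha : a ∈ component (Γ.datum K) 1 d) : ∃ p, ∀ f,
      WeylAlgebra.diffRep K E (lift (Γ.isRep_z K) a) f = p * shift (Γ.γ d) f := by
  induction ha using Submodule.span_induction with
  | zero => exact ⟨0, by simp⟩
  | add a b _ _ ha hb =>
    obtain ⟨p, hp⟩ := ha
    obtain ⟨q, hq⟩ := hb
    exact ⟨p + q, fun f => by simp [hp, hq, add_mul]⟩
  | smul c a _ ha =>
    obtain ⟨p, hp⟩ := ha
    exact ⟨c • p, fun f => by simp [hp]⟩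
  | mem a ha =>
    obtain ⟨w, rfl, rfl⟩ := ha
    induction w with
    | nil => exact ⟨1, by simp⟩
    | cons g w ih =>
      obtain ⟨p, hp⟩ := ih
      obtain ⟨q, hq⟩ : ∃ q, ∀ f, WeylAlgebra.diffRep K E
          (lift (Γ.isRep_z K) (gen (Γ.datum K) 1 g)) f = q * shift (Γ.γ g.deg) f := by
        cases g with
        | coeff r => exact ⟨r, fun f => by simp [genVal, TGWGen.deg]⟩
        | X v => exact ⟨_, fun f => by
            rw [lift_gen, genVal, WeylAlgebra.diffRep_z, TGWGen.deg, γ_single]⟩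
        | Y v => exact ⟨_, fun f => by
            rw [lift_gen, genVal, WeylAlgebra.diffRep_z, TGWGen.deg, map_neg, γ_single]⟩
      refine ⟨q * shift (Γ.γ g.deg) p, fun f => ?_⟩
      simp only [List.map_cons, List.prod_cons, List.sum_cons, map_mul, Module.End.mul_apply]
        at hp ⊢
      rw [hp, hq, map_mul, shift_shift, map_add, mul_assoc]

theorem exists_diffRep_coeff (a : Γ.Alg K) (d : V →₀ ℤ) : ∃ p, ∀ f,
    WeylAlgebra.diffRep K E (((Γ.isRep_z_regular K).gradedHom a).coeff d) f =
      p * shift (Γ.γ d) f := by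
  classical
  obtain ⟨a, rfl⟩ := Ideal.Quotient.mk_surjective a
  rw [IsRep.Regular.gradedHom_mk]
  have ha : a ∈ ⨆ d, component (Γ.datum K) 1 d := iSup_component (Γ.datum K) ▸ Submodule.mem_top
  induction ha using Submodule.iSup_induction' with
  | zero => exact ⟨0, by simp⟩
  | add a b _ _ ha hb =>
    obtain ⟨p, hp⟩ := ha
    obtain ⟨q, hq⟩ := hb
    exact ⟨p + q, fun f => by simp [hp, hq, add_mul]⟩
  | mem c a ha =>
    rw [IsRep.lift_graded_of_mem _ ha, AddMonoidAlgebra.coeff_single, Finsupp.single_apply]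
    split_ifs with h
    · exact h ▸ Γ.exists_diffRep_lift K ha
    · exact ⟨0, by simp⟩

theorem gradedHom_ρ (r : MvPolynomial E K) : (Γ.isRep_z_regular K).gradedHom (Γ.ρ K r) =
    AddMonoidAlgebra.single 0 (WeylAlgebra.polyHom K E r) := by
  rw [ρ_eq_mk, IsRep.Regular.gradedHom_mk, (Γ.isRep_z K).lift_graded_gen, lift_gen]
  rfl

/-! ### Injectivity of the representation and maximality of the polynomial subalgebra -/

theorem canonicalRep_injective (h : Function.Injective Γ.γ) :
    Function.Injective (Γ.canonicalRep K) := by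
  rw [injective_iff_map_eq_zero]
  intro a ha
  refine (Γ.isRep_z_regular K).gradedHom_injective ?_
  rw [map_zero, ← AddMonoidAlgebra.coeff_eq_zero]
  choose p hp using Γ.exists_diffRep_coeff K a
  set c := ((Γ.isRep_z_regular K).gradedHom a).coeff with hc
  have hsum : c.sum (fun _ b => b) = 0 := by
    rw [← ha, canonicalRep, IsRep.Regular.hom, AlgHom.comp_apply, IsRep.forgetDegree_eq_sum]
  have hsum' : ∑ d ∈ c.support, p d •
      (fun f : MvPolynomial E K => (shift (Γ.γ d) f : MvPolynomial E K)) = 0 := by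
    funext f
    have := LinearMap.congr_fun (congrArg (WeylAlgebra.diffRep K E) hsum) f
    rw [map_zero, LinearMap.zero_apply, Finsupp.sum, map_sum, LinearMap.sum_apply] at this
    rw [Finset.sum_apply, Pi.zero_apply, ← this]
    exact Finset.sum_congr rfl fun d _ => (hp d f).symm
  -- Injectivity of `γ` keeps the translations for distinct degrees distinct, so each homogeneous
  -- part must act by zero.
  have hli := (MvPolynomial.linearIndependent_shift (K := K) (E := E)).comp Γ.γ h
  have h0 := linearIndependent_iff'.1 hli c.support p hsum'
  ext d : 1
  by_contra hd
  refine hd (WeylAlgebra.diffRep_injective K E (LinearMap.ext fun f => ?_))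
  rw [hp, h0 d (Finsupp.mem_support_iff.2 hd)]
  simp

/-- If `γ d = 0` with `d ≠ 0`, then there is an element of degree `d` that is not in `R_E`
although the canonical representation maps it to `φ(R_E)`. -/
theorem exists_not_mem_range_ρ {d : V →₀ ℤ} (hd : d ≠ 0) (h : Γ.γ d = 0) :
    ∃ a : Γ.Alg K, a ∉ (Γ.ρ K).range ∧ (∀ r, Commute a (Γ.ρ K r)) ∧
      ∃ p, Γ.canonicalRep K a = Γ.canonicalRep K (Γ.ρ K p) := by
  obtain ⟨c, hc, hreg⟩ := (Γ.isRep_z_regular K).exists_mem_component d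
  obtain ⟨p, hp⟩ := Γ.exists_diffRep_lift K hc
  -- As `γ(d) = 0`, the translation is trivial and `c` acts as multiplication by `p`.
  have hcp : lift (Γ.isRep_z K) c = WeylAlgebra.polyHom K E p :=
    WeylAlgebra.diffRep_injective K E (LinearMap.ext fun f => by simp [hp, h])
  have hgr := (Γ.isRep_z_regular K).gradedHom_mk c
  rw [(Γ.isRep_z K).lift_graded_of_mem hc] at hgr
  refine ⟨Ideal.Quotient.mk _ c, ?_, ?_, p, ?_⟩
  · rintro ⟨r, hr⟩
    replace hr : Γ.ρ K r = _ := hr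
    have h1 := congrArg (fun a => ((Γ.isRep_z_regular K).gradedHom a).coeff d) hr
    simp only [gradedHom_ρ, hgr, AddMonoidAlgebra.coeff_single,
      Finsupp.single_eq_same, Finsupp.single_eq_of_ne hd] at h1
    -- Elements of `R_E` have no part in degree `d ≠ 0`, so `c` would act by zero although it acts
    -- regularly.
    have : (1 : WeylAlgebra K E) = 0 := hreg (by simp [← h1])
    refine one_ne_zero (α := MvPolynomial E K) (WeylAlgebra.polyHom_injective K E ?_)
    rw [map_one, map_zero, this]
  · intro r
    refine (Γ.isRep_z_regular K).gradedHom_injective ?_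
    rw [map_mul, map_mul, gradedHom_ρ, hgr, AddMonoidAlgebra.single_mul_single,
      AddMonoidAlgebra.single_mul_single, hcp, ← map_mul, ← map_mul, mul_comm p, add_comm d]
  · rw [canonicalRep_ρ, canonicalRep, IsRep.Regular.hom_mk, hcp]

theorem γ_injective_of_canonicalRep_injective (h : Function.Injective (Γ.canonicalRep K)) :
    Function.Injective Γ.γ := by
  rw [injective_iff_map_eq_zero]
  intro d hd
  by_contra hd0
  obtain ⟨a, ha, -, p, hp⟩ := Γ.exists_not_mem_range_ρ K hd0 hd
  exact ha ⟨p, (h hp).symm⟩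

/-- Adjoining to `R_E` an outside element that commutes with it would give a larger commutative
subalgebra. -/
theorem γ_injective_of_maximal (h : Maximal
    (fun S : Subalgebra K (Γ.Alg K) => ∀ a ∈ S, ∀ b ∈ S, a * b = b * a) (Γ.ρ K).range) :
    Function.Injective Γ.γ := by
  rw [injective_iff_map_eq_zero]
  intro d hd
  by_contra hd0
  obtain ⟨a, ha, hcomm, -⟩ := Γ.exists_not_mem_range_ρ K hd0 hd
  have hS : ∀ b ∈ insert a ((Γ.ρ K).range : Set (Γ.Alg K)),
      ∀ c ∈ insert a ((Γ.ρ K).range : Set (Γ.Alg K)), b * c = c * b := by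
    rintro b (rfl | hb) c (rfl | hc)
    · rfl
    · obtain ⟨r, rfl⟩ := hc
      exact hcomm r
    · obtain ⟨r, rfl⟩ := hb
      exact (hcomm r).symm
    · exact h.prop b hb c hc
  have := Algebra.isMulCommutative_adjoin K hS
  refine ha (h.le_of_ge (y := Algebra.adjoin K (insert a ((Γ.ρ K).range : Set (Γ.Alg K)))) ?_ ?_
    (Algebra.subset_adjoin (Set.mem_insert _ _)))
  · intro b hb c hc
    exact setLike_mul_comm hb hc
  · exact fun b hb => Algebra.subset_adjoin (Set.mem_insert_of_mem _ hb)

/-- In degree `d`, commuting with `u_e` means `p_d (u_e - γ(d)_e) = u_e p_d`, that is, `p_d γ(d)_e =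
0`. For `d ≠ 0` some entry of `γ(d)` is nonzero, so only degree zero survives. -/
theorem mem_range_ρ_of_commute (h : Function.Injective Γ.γ) {a : Γ.Alg K}
    (ha : ∀ e, Commute a (Γ.ρ K (MvPolynomial.X e))) : a ∈ (Γ.ρ K).range := by
  choose p hp using Γ.exists_diffRep_coeff K a
  refine ⟨p 0, (Γ.isRep_z_regular K).gradedHom_injective ?_⟩
  change (Γ.isRep_z_regular K).gradedHom (Γ.ρ K (p 0)) = _
  rw [gradedHom_ρ, ← AddMonoidAlgebra.coeff_inj]
  refine Finsupp.ext fun d => WeylAlgebra.diffRep_injective K E (LinearMap.ext fun f => ?_)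
  rw [hp, AddMonoidAlgebra.coeff_single]
  rcases eq_or_ne d 0 with rfl | hd
  · simp
  · have hγ : Γ.γ d ≠ 0 := fun h0 => hd (h (by rw [h0, map_zero]))
    obtain ⟨e, he⟩ := Finsupp.ne_iff.1 hγ
    have h1 := congrArg (fun a => ((Γ.isRep_z_regular K).gradedHom a).coeff d) (ha e).eq
    simp only [map_mul, gradedHom_ρ, AddMonoidAlgebra.coeff_mul_single_zero,
      AddMonoidAlgebra.coeff_single_zero_mul] at h1
    have h2 := LinearMap.congr_fun (congrArg (WeylAlgebra.diffRep K E) h1) 1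
    simp only [map_mul, Module.End.mul_apply, hp, WeylAlgebra.diffRep_polyHom, mul_one,
      map_one, MvPolynomial.shift_X] at h2
    have h3 : p d * MvPolynomial.C (Γ.γ d e : K) = 0 := by linear_combination -h2
    have h4 : p d = 0 := (mul_eq_zero.1 h3).resolve_right (by simpa using he)
    simp [h4, Finsupp.single_eq_of_ne hd]

theorem maximal_of_γ_injective (h : Function.Injective Γ.γ) : Maximal
    (fun S : Subalgebra K (Γ.Alg K) => ∀ a ∈ S, ∀ b ∈ S, a * b = b * a) (Γ.ρ K).range := by
  refine ⟨?_, fun S hS hle a ha => ?_⟩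
  · rintro _ ⟨r, rfl⟩ _ ⟨s, rfl⟩
    exact (Commute.all r s).map (Γ.ρ K)
  · exact Γ.mem_range_ρ_of_commute K h fun e => hS a ha _ (hle ⟨_, rfl⟩)

end Multiquiver

end

noncomputable section

/-! ### Equilibrium and the kernel of the incidence matrix -/

namespace Multiquiver

variable {V E : Type*} (Γ : Multiquiver V E)

/-! #### Potentials -/

/-- A potential is a function on vertices such that `m k(u) = n k(v)` for every edge with source
`(u, m)` and target `(v, n)`. -/
def IsPotential (k : V → ℚ) : Prop :=
  ∀ e u m v n, Γ.s e = some (u, m) → Γ.t e = some (v, n) → ((m : ℕ) : ℚ) * k u = ((n : ℕ) : ℚ) * k v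

variable {Γ} in
theorem IsPotential.subgraph {k : V → ℚ} (hk : Γ.IsPotential k) (V' : Set V) (E' : Set E) :
    (Γ.subgraph V' E').IsPotential fun v => k v :=
  fun e _ _ _ _ hs ht => hk e _ _ _ _ (restrictEnd_eq_some hs) (restrictEnd_eq_some ht)

/-- The equation `m k(u) = n k(v)` is symmetric in the two ends, so it does not see orientations. -/
theorem SignEquivalent.exists_equiv_isPotential {V₁ E₁ V₂ E₂ : Type*} {Γ₁ : Multiquiver V₁ E₁}
    {Γ₂ : Multiquiver V₂ E₂} (h : SignEquivalent Γ₁ Γ₂) :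
    ∃ f : V₁ ≃ V₂, ∀ k : V₂ → ℚ, Γ₁.IsPotential (k ∘ f) ↔ Γ₂.IsPotential k := by
  obtain ⟨f, g, hfg⟩ := h
  refine ⟨f, fun k => ⟨fun hk e u m v n hs ht => ?_, fun hk e u m v n hs ht => ?_⟩⟩
  · obtain ⟨e, rfl⟩ := g.surjective e
    rcases hfg e with ⟨h₁, h₂⟩ | ⟨h₁, h₂⟩
    all_goals
      rw [hs] at h₁
      rw [ht] at h₂
      obtain ⟨⟨u', m'⟩, hs', h₁⟩ := Option.map_eq_some_iff.1 h₁.symm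
      obtain ⟨⟨v', n'⟩, ht', h₂⟩ := Option.map_eq_some_iff.1 h₂.symm
      simp only [Prod.map_apply, id_eq, Prod.mk.injEq] at h₁ h₂
      obtain ⟨rfl, rfl⟩ := h₁
      obtain ⟨rfl, rfl⟩ := h₂
    · exact hk e _ _ _ _ hs' ht'
    · exact (hk e _ _ _ _ ht' hs').symm
  · rcases hfg e with ⟨h₁, h₂⟩ | ⟨h₁, h₂⟩
    all_goals
      simp only [hs, ht, Option.map_some, Prod.map_apply, id_eq] at h₁ h₂
    · exact hk _ _ _ _ _ h₁ h₂
    · exact (hk _ _ _ _ _ h₁ h₂).symm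

theorem pnat_prod_eq_prod {ι : Type*} {s : Finset ι} {a b : ι → ℕ+}
    (h : ∏ i ∈ s, ((a i : ℕ) : ℚ) = ∏ i ∈ s, ((b i : ℕ) : ℚ)) : ∏ i ∈ s, a i = ∏ i ∈ s, b i := by
  apply PNat.coe_injective
  push_cast
  exact_mod_cast h

/-- Multiply the edge equations around the cycle; the rotation permutes the vertices, so the nonzero
vertex values cancel. -/
theorem IsDirectedCycleVia.prod_eq_of_isPotential {Γ : Multiquiver V E} {n : ℕ} {v : Fin n ≃ V}
    {e : Fin n ≃ E} {a b : Fin n → ℕ+} (h : Γ.IsDirectedCycleVia v e a b) {k : V → ℚ}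
    (hk : Γ.IsPotential k) (hk0 : ∀ v, k v ≠ 0) : ∏ i, a i = ∏ i, b i := by
  have h1 : ∏ i, (((a i : ℕ) : ℚ) * k (v i)) =
      ∏ i, (((b i : ℕ) : ℚ) * k (v (finRotate n i))) :=
    Finset.prod_congr rfl fun i _ => hk (e i) _ _ _ _ (h i).1 (h i).2
  rw [Finset.prod_mul_distrib, Finset.prod_mul_distrib,
    Equiv.prod_comp (finRotate n) fun i => k (v i)] at h1
  have h2 := mul_right_cancel₀ (Finset.prod_ne_zero_iff.2 fun i _ => hk0 (v i)) h1
  exact pnat_prod_eq_prod h2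

/-- The value at the `i`-th vertex is the partial product of the ratios `a_j / b_j` over `j < i`;
balance says exactly that the last edge closes up. -/
theorem IsBalancedDirectedCycle.exists_isPotential {Γ : Multiquiver V E}
    (h : Γ.IsBalancedDirectedCycle) : ∃ k : V → ℚ, Γ.IsPotential k ∧ ∀ v, k v ≠ 0 := by
  obtain ⟨n, v, e, a, b, hn, hvia, hab⟩ := h
  obtain ⟨n, rfl⟩ := Nat.exists_eq_add_one_of_ne_zero hn.ne'
  set c : ℕ → ℚ := fun j => if h : j < n + 1 then ((a ⟨j, h⟩ : ℕ) : ℚ) / (b ⟨j, h⟩ : ℕ) else 1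
    with hc
  have hcv : ∀ i : Fin (n + 1), c i = ((a i : ℕ) : ℚ) / (b i : ℕ) := fun i =>
    dif_pos i.2
  have hpos : ∀ m : ℕ+, ((m : ℕ) : ℚ) ≠ 0 := fun m => by exact_mod_cast m.ne_zero
  have hc0 : ∀ j, c j ≠ 0 := fun j => by
    simp only [hc]
    split_ifs
    · exact div_ne_zero (hpos _) (hpos _)
    · exact one_ne_zero
  have hprod : ∏ j ∈ Finset.range (n + 1), c j = 1 := by
    rw [Finset.prod_range]
    simp only [hcv, Finset.prod_div_distrib]
    rw [div_eq_one_iff_eq (Finset.prod_ne_zero_iff.2 fun i _ => hpos _)]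
    have := congrArg (fun m : ℕ+ => ((m : ℕ) : ℚ)) hab
    push_cast at this
    exact this
  refine ⟨fun w => ∏ j ∈ Finset.range (v.symm w), c j, ?_, fun w =>
    Finset.prod_ne_zero_iff.2 fun j _ => hc0 j⟩
  intro f u m w p hs ht
  obtain ⟨i, rfl⟩ := e.surjective f
  rw [(hvia i).1] at hs
  rw [(hvia i).2] at ht
  simp only [Option.some.injEq, Prod.mk.injEq] at hs ht
  obtain ⟨rfl, rfl⟩ := hs
  obtain ⟨rfl, rfl⟩ := ht
  have hstep : ∏ j ∈ Finset.range (finRotate (n + 1) i), c j =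
      (∏ j ∈ Finset.range i, c j) * c i := by
    rw [← Finset.prod_range_succ, coe_finRotate]
    split_ifs with hi
    · rw [hi, Fin.val_last, hprod, Finset.range_zero, Finset.prod_empty]
    · rfl
  simp only [Equiv.symm_apply_apply]
  rw [hstep, hcv]
  have := hpos (b i)
  field_simp

/-! #### Closed walks -/

/-- The edge `e` joins `u` (with multiplicity `a`) and `v` (with multiplicity `b`), in one of the
two directions. -/
def Link (e : E) (u v : V) (a b : ℕ+) : Prop :=
  (Γ.s e = some (u, a) ∧ Γ.t e = some (v, b)) ∨ (Γ.t e = some (u, a) ∧ Γ.s e = some (v, b))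

variable {Γ}

theorem Link.symm {e : E} {u v : V} {a b : ℕ+} (h : Γ.Link e u v a b) : Γ.Link e v u b a :=
  h.elim (fun h => .inr ⟨h.2, h.1⟩) fun h => .inl ⟨h.2, h.1⟩

theorem Link.ne {e : E} {u v : V} {a b : ℕ+} (h : Γ.Link e u v a b) : u ≠ v :=
  h.elim (fun h => Γ.no_loops e _ _ _ _ h.1 h.2) fun h => (Γ.no_loops e _ _ _ _ h.2 h.1).symm

theorem Link.eq_or_eq {e : E} {u v u' v' : V} {a b a' b' : ℕ+} (h : Γ.Link e u v a b)
    (h' : Γ.Link e u' v' a' b') :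
    (u = u' ∧ v = v' ∧ a = a' ∧ b = b') ∨ (u = v' ∧ v = u' ∧ a = b' ∧ b = a') := by
  rcases h with ⟨h₁, h₂⟩ | ⟨h₁, h₂⟩ <;> rcases h' with ⟨h₃, h₄⟩ | ⟨h₃, h₄⟩
  all_goals
    simp only [h₁, h₂, Option.some.injEq, Prod.mk.injEq] at h₃ h₄
    tauto

theorem Link.isPotential {e : E} {u v : V} {a b : ℕ+} (h : Γ.Link e u v a b) {k : V → ℚ}
    (hk : Γ.IsPotential k) : ((a : ℕ) : ℚ) * k u = ((b : ℕ) : ℚ) * k v :=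
  h.elim (fun h => hk e _ _ _ _ h.1 h.2) fun h => (hk e _ _ _ _ h.2 h.1).symm

theorem restrictEnd_some {V' : Set V} {v : V} (h : v ∈ V') (n : ℕ+) :
    restrictEnd V' (some (v, n)) = some (⟨v, h⟩, n) := by
  simp [restrictEnd, h]

theorem Link.subgraph {V' : Set V} {E' : Set E} {e : E} {u v : V} {a b : ℕ+}
    (h : Γ.Link e u v a b) (he : e ∈ E') (hu : u ∈ V') (hv : v ∈ V') :
    (Γ.subgraph V' E').Link ⟨e, he⟩ ⟨u, hu⟩ ⟨v, hv⟩ a b := by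
  rcases h with ⟨h₁, h₂⟩ | ⟨h₁, h₂⟩
  · exact .inl ⟨by simp only [Multiquiver.subgraph, h₁, restrictEnd_some hu],
      by simp only [Multiquiver.subgraph, h₂, restrictEnd_some hv]⟩
  · exact .inr ⟨by simp only [Multiquiver.subgraph, h₁, restrictEnd_some hu],
      by simp only [Multiquiver.subgraph, h₂, restrictEnd_some hv]⟩

/-- Enumerations of vertices and edges whose links close up exhibit an NND cycle. -/
theorem isNNDCycle_of_link {n : ℕ} (hn : 0 < n) (v : Fin n ≃ V) (e : Fin n ≃ E) (a b : Fin n → ℕ+)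
    (h : ∀ i, Γ.Link (e i) (v i) (v (finRotate n i)) (a i) (b i)) : Γ.IsNNDCycle := by
  have := Finite.of_equiv _ e
  let Γ' : Multiquiver V E :=
    { s := fun f => some (v (e.symm f), a (e.symm f))
      t := fun f => some (v (finRotate n (e.symm f)), b (e.symm f))
      no_loops := by
        intro f u m w p hs ht
        simp only [Option.some.injEq, Prod.mk.injEq] at hs ht
        rw [← hs.1, ← ht.1]
        exact (h (e.symm f)).ne
      finite_s := fun _ => Set.toFinite _
      finite_t := fun _ => Set.toFinite _ }
  refine ⟨Γ', ⟨n, v, e, a, b, hn, fun i => by simp [Γ']⟩, Equiv.refl _, Equiv.refl _, fun f => ?_⟩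
  obtain ⟨i, rfl⟩ := e.surjective f
  rcases h i with ⟨h₁, h₂⟩ | ⟨h₁, h₂⟩
  · exact .inl (by simp [Γ', h₁, h₂])
  · exact .inr (by simp [Γ', h₁, h₂])

/-- A closed walk without repeated vertices or edges is balanced. -/
theorem prod_eq_prod_of_injOn
    (hbal : ∀ (V' : Set V) (E' : Set E), (Γ.subgraph V' E').IsNNDCycle →
      (Γ.subgraph V' E').IsBalancedNNDCycle)
    {n : ℕ} {w : ℕ → V} {e : ℕ → E} {a b : ℕ → ℕ+}
    (h : ∀ i < n, Γ.Link (e i) (w i) (w (i + 1)) (a i) (b i)) (hw : w n = w 0)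
    (hwi : Set.InjOn w (Set.Iio n)) (hei : Set.InjOn e (Set.Iio n)) :
    ∏ i ∈ Finset.range n, a i = ∏ i ∈ Finset.range n, b i := by
  classical
  rcases n with _ | n
  · simp
  set V' : Set V := w '' Set.Iio (n + 1)
  set E' : Set E := e '' Set.Iio (n + 1)
  have hV : ∀ i : Fin (n + 1), w i ∈ V' := fun i => ⟨i, i.2, rfl⟩
  have hE : ∀ i : Fin (n + 1), e i ∈ E' := fun i => ⟨i, i.2, rfl⟩
  have hV' : ∀ i < n + 1, w (i + 1) ∈ V' := by
    intro i hi
    rcases Nat.lt_succ_iff_lt_or_eq.1 hi with hi | rfl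
    · exact ⟨i + 1, by simpa using hi, rfl⟩
    · exact ⟨0, by simp, hw.symm⟩
  let v : Fin (n + 1) ≃ V' := Equiv.ofBijective (fun i => ⟨w i, hV i⟩)
    ⟨fun i j hij => Fin.ext (hwi i.2 j.2 (congrArg Subtype.val hij)), by
      rintro ⟨_, i, hi, rfl⟩
      exact ⟨⟨i, hi⟩, rfl⟩⟩
  let f : Fin (n + 1) ≃ E' := Equiv.ofBijective (fun i => ⟨e i, hE i⟩)
    ⟨fun i j hij => Fin.ext (hei i.2 j.2 (congrArg Subtype.val hij)), by
      rintro ⟨_, i, hi, rfl⟩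
      exact ⟨⟨i, hi⟩, rfl⟩⟩
  have hcyc : (Γ.subgraph V' E').IsNNDCycle := by
    refine isNNDCycle_of_link n.succ_pos v f (fun i => a i) (fun i => b i) fun i => ?_
    have hrot : v (finRotate (n + 1) i) = ⟨w (i + 1), hV' i i.2⟩ := by
      refine Subtype.ext ?_
      change w (finRotate (n + 1) i) = w (i + 1)
      rw [coe_finRotate]
      split_ifs with hi
      · rw [hi, Fin.val_last, hw]
      · rfl
    rw [hrot]
    exact (h i i.2).subgraph (hE i) (hV i) (hV' i i.2)
  -- Balance is witnessed by an enumeration and an orientation unrelated to the given walk. A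
  -- potential forgets both, so it carries the equality of products back to the walk.
  obtain ⟨Γ', hΓ', hse⟩ := hbal V' E' hcyc
  obtain ⟨k, hk, hk0⟩ := hΓ'.exists_isPotential
  obtain ⟨g, hg⟩ := hse.exists_equiv_isPotential
  have hk' := (hg k).2 hk
  -- The default `1` keeps the extension nowhere zero, for the cancellation below.
  set l : V → ℚ := fun u => if hu : u ∈ V' then k (g ⟨u, hu⟩) else 1 with hl
  have hl0 : ∀ u, l u ≠ 0 := fun u => by
    simp only [hl]
    split_ifs
    · exact hk0 _
    · exact one_ne_zero
  have hlink : ∀ i ∈ Finset.range (n + 1),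
      ((a i : ℕ) : ℚ) * l (w i) = ((b i : ℕ) : ℚ) * l (w (i + 1)) := by
    intro i hi
    have hi' := Finset.mem_range.1 hi
    have := ((h i hi').subgraph (hE ⟨i, hi'⟩) (hV ⟨i, hi'⟩) (hV' i hi')).isPotential hk'
    simp only [hl, dif_pos (hV ⟨i, hi'⟩), dif_pos (hV' i hi')]
    exact this
  have hprod := Finset.prod_congr rfl hlink
  have hshift : ∏ i ∈ Finset.range (n + 1), l (w (i + 1)) = ∏ i ∈ Finset.range (n + 1), l (w i) := by
    rw [Finset.prod_range_succ, hw, ← Finset.prod_range_succ' fun i => l (w i)]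
  rw [Finset.prod_mul_distrib, Finset.prod_mul_distrib, hshift] at hprod
  have h2 := mul_right_cancel₀ (Finset.prod_ne_zero_iff.2 fun i _ => hl0 (w i)) hprod
  exact pnat_prod_eq_prod h2

/-- If all NND cycles are balanced, then so are all closed walks. -/
theorem prod_eq_prod_of_closed
    (hbal : ∀ (V' : Set V) (E' : Set E), (Γ.subgraph V' E').IsNNDCycle →
      (Γ.subgraph V' E').IsBalancedNNDCycle)
    (n : ℕ) {w : ℕ → V} {e : ℕ → E} {a b : ℕ → ℕ+}
    (h : ∀ i < n, Γ.Link (e i) (w i) (w (i + 1)) (a i) (b i)) (hw : w n = w 0) :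
    ∏ i ∈ Finset.range n, a i = ∏ i ∈ Finset.range n, b i := by
  induction n using Nat.strong_induction_on generalizing w e a b with
  | _ n ih =>
  by_cases hwi : Set.InjOn w (Set.Iio n)
  · by_cases hei : Set.InjOn e (Set.Iio n)
    · exact prod_eq_prod_of_injOn hbal h hw hwi hei
    · obtain ⟨i, hi, j, hj, hij, hne⟩ : ∃ i < n, ∃ j < n, e i = e j ∧ i < j := by
        simp only [Set.InjOn, Set.mem_Iio] at hei
        push Not at hei
        obtain ⟨i, hi, j, hj, hij, hne⟩ := hei
        rcases lt_or_gt_of_ne hne with hlt | hlt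
        exacts [⟨i, hi, j, hj, hij, hlt⟩, ⟨j, hj, i, hi, hij.symm, hlt⟩]
      -- With distinct vertices a repeated edge must be traversed in opposite directions, which
      -- forces `i = 0`, `j = 1`, `n = 2`: one step and its reversal.
      rcases (h i hi).eq_or_eq (hij ▸ h j hj) with ⟨h₁, -⟩ | ⟨h₁, h₂, h₃, h₄⟩
      · exact absurd (hwi hi hj h₁) hne.ne
      · have hj' : j + 1 = n := by
          by_contra hj'
          have := hwi hi (show j + 1 < n by lia) h₁
          lia
        have hi0 : i = 0 := by
          rw [hj', hw] at h₁
          exact hwi hi (show 0 < n by lia) h₁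
        subst hi0
        have hj1 : 1 = j := hwi (show 0 + 1 < n by lia) hj h₂
        subst hj1
        subst hj'
        simp [Finset.prod_range_succ, h₃, h₄, mul_comm]
  · obtain ⟨i, hi, j, hj, hij, hne⟩ : ∃ i < n, ∃ j < n, w i = w j ∧ i < j := by
      simp only [Set.InjOn, Set.mem_Iio] at hwi
      push Not at hwi
      obtain ⟨i, hi, j, hj, hij, hne⟩ := hwi
      rcases lt_or_gt_of_ne hne with hlt | hlt
      exacts [⟨i, hi, j, hj, hij, hlt⟩, ⟨j, hj, i, hi, hij.symm, hlt⟩]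
    -- A repeated vertex cuts the walk into an inner loop of length `p` and the outer walk that
    -- skips it, of length `i + q`; both are shorter.
    obtain ⟨p, rfl⟩ := Nat.exists_eq_add_of_le hne.le
    obtain ⟨q, rfl⟩ := Nat.exists_eq_add_of_le hj.le
    have hinner := ih p (by lia) (w := fun l => w (i + l)) (e := fun l => e (i + l))
      (a := fun l => a (i + l)) (b := fun l => b (i + l)) (fun l hl => h (i + l) (by lia)) hij.symm
    have houter := ih (i + q) (by lia) (w := fun l => if l ≤ i then w l else w (l + p))
      (e := fun l => if l < i then e l else e (l + p))
      (a := fun l => if l < i then a l else a (l + p))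
      (b := fun l => if l < i then b l else b (l + p)) (by
        intro l hl
        rcases lt_trichotomy l i with hli | rfl | hli
        · simp only [hli, hli.le, if_true, Nat.succ_le_of_lt hli]
          exact h l (by lia)
        · have h1 : ¬ l + 1 ≤ l := by lia
          simp only [le_refl, lt_irrefl, if_true, if_false, h1, hij]
          have := h (l + p) (by lia)
          rwa [show l + p + 1 = l + 1 + p by lia] at this
        · have h1 : ¬ l + 1 ≤ i := by lia
          simp only [hli.not_gt, hli.not_ge, if_false, h1]
          have := h (l + p) (by lia)
          rwa [show l + p + 1 = l + 1 + p by lia] at this) (by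
        have h1 : ¬ i + q ≤ i := by lia
        simp only [h1, if_false, Nat.zero_le, if_true]
        rw [← hw, show i + q + p = i + p + q by lia])
    have hsplit : ∀ c : ℕ → ℕ+, ∏ l ∈ Finset.range (i + p + q), c l =
        (∏ l ∈ Finset.range p, c (i + l)) *
          ∏ l ∈ Finset.range (i + q), if l < i then c l else c (l + p) := by
      intro c
      have h1 : ∏ l ∈ Finset.range i, (if l < i then c l else c (l + p)) =
          ∏ l ∈ Finset.range i, c l :=
        Finset.prod_congr rfl fun l hl => if_pos (Finset.mem_range.1 hl)
      have h2 : ∏ l ∈ Finset.range q, (if i + l < i then c (i + l) else c (i + l + p)) =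
          ∏ l ∈ Finset.range q, c (i + p + l) :=
        Finset.prod_congr rfl fun l _ => by
          rw [if_neg (by lia), show i + l + p = i + p + l by lia]
      rw [Finset.prod_range_add, Finset.prod_range_add, Finset.prod_range_add, h1, h2,
        mul_comm (∏ l ∈ Finset.range i, c l), mul_assoc]
    rw [hsplit, hsplit, hinner, houter]

variable (Γ) in
/-- `Γ.Holonomy u v c`: there is a walk from `u` to `v` along which potentials are multiplied
by `c`. -/
inductive Holonomy : V → V → ℚ → Prop
  | refl (u : V) : Holonomy u u 1
  | step {u v w : V} {c : ℚ} {e : E} {a b : ℕ+} (h : Holonomy u v c) (hl : Γ.Link e v w a b) :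
      Holonomy u w (c * (((a : ℕ) : ℚ) / (b : ℕ)))

namespace Holonomy

theorem trans {u v w : V} {c d : ℚ} (h : Γ.Holonomy u v c) (h' : Γ.Holonomy v w d) :
    Γ.Holonomy u w (c * d) := by
  induction h' with
  | refl => simpa using h
  | step _ hl ih => simpa [mul_assoc] using ih.step hl

theorem symm {u v : V} {c : ℚ} (h : Γ.Holonomy u v c) : Γ.Holonomy v u c⁻¹ := by
  induction h with
  | refl => simpa using refl _
  | step _ hl ih => simpa [mul_inv] using ((refl _).step hl.symm).trans ih

theorem ne_zero {u v : V} {c : ℚ} (h : Γ.Holonomy u v c) : c ≠ 0 := by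
  induction h with
  | refl => exact one_ne_zero
  | step _ _ ih => exact mul_ne_zero ih (div_ne_zero (by simp) (by simp))

/-- Passes to the indexed form used for closed walks. An edge is needed as a dummy value of the
sequence beyond the end of the walk. -/
theorem exists_walk [Nonempty E] {u v : V} {c : ℚ} (h : Γ.Holonomy u v c) :
    ∃ (n : ℕ) (w : ℕ → V) (e : ℕ → E) (a b : ℕ → ℕ+),
      (∀ i < n, Γ.Link (e i) (w i) (w (i + 1)) (a i) (b i)) ∧ w 0 = u ∧ w n = v ∧
      c = ((∏ i ∈ Finset.range n, a i : ℕ+) : ℕ) / ((∏ i ∈ Finset.range n, b i : ℕ+) : ℕ) := by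
  induction h with
  | refl =>
    exact ⟨0, fun _ => u, fun _ => Classical.arbitrary E, 1, 1, by simp, rfl, rfl, by simp⟩
  | @step v x c f p q _ hl ih =>
    obtain ⟨n, w, e, a, b, hlink, h0, hn, hc⟩ := ih
    refine ⟨n + 1, Function.update w (n + 1) x, Function.update e n f, Function.update a n p,
      Function.update b n q, ?_, ?_, ?_, ?_⟩
    · intro i hi
      rcases Nat.lt_succ_iff_lt_or_eq.1 hi with hi | rfl
      · have h1 : i ≠ n + 1 := by lia
        have h2 : i ≠ n := by lia
        have h3 : i + 1 ≠ n + 1 := by lia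
        simpa only [Function.update_of_ne h1, Function.update_of_ne h2, Function.update_of_ne h3]
          using hlink i hi
      · have h1 : i ≠ i + 1 := by lia
        simpa only [Function.update_self, Function.update_of_ne h1, hn] using hl
    · rw [Function.update_of_ne (by lia), h0]
    · rw [Function.update_self]
    · have hup : ∀ (g : ℕ → ℕ+) (r : ℕ+), ∏ i ∈ Finset.range (n + 1), Function.update g n r i =
          (∏ i ∈ Finset.range n, g i) * r := by
        intro g r
        rw [Finset.prod_range_succ, Function.update_self]
        congr 1
        exact Finset.prod_congr rfl fun i hi =>
          Function.update_of_ne (Finset.mem_range.1 hi).ne _ _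
      rw [hup, hup, hc, PNat.mul_coe, PNat.mul_coe, Nat.cast_mul, Nat.cast_mul, mul_div_mul_comm]

theorem eq_one_of_closed
    (hbal : ∀ (V' : Set V) (E' : Set E), (Γ.subgraph V' E').IsNNDCycle →
      (Γ.subgraph V' E').IsBalancedNNDCycle)
    {u : V} {c : ℚ} (h : Γ.Holonomy u u c) : c = 1 := by
  rcases isEmpty_or_nonempty E with hE | hE
  · cases h with
    | refl => rfl
    | @step _ _ _ e => exact hE.elim e
  · obtain ⟨n, w, e, a, b, hlink, h0, hn, rfl⟩ := h.exists_walk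
    rw [prod_eq_prod_of_closed hbal n hlink (hn.trans h0.symm)]
    exact div_self (by exact_mod_cast PNat.ne_zero _)

end Holonomy

/-- If all NND cycles are balanced and any vertex can be reached from a fixed one, then there is a
nowhere vanishing potential. -/
theorem exists_isPotential
    (hbal : ∀ (V' : Set V) (E' : Set E), (Γ.subgraph V' E').IsNNDCycle →
      (Γ.subgraph V' E').IsBalancedNNDCycle)
    (u : V) (hconn : ∀ v, ∃ c, Γ.Holonomy u v c) :
    ∃ k : V → ℚ, Γ.IsPotential k ∧ ∀ v, k v ≠ 0 := by
  choose k hk using hconn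
  refine ⟨k, fun e v m w n hs ht => ?_, fun v => (hk v).ne_zero⟩
  -- `k` is the holonomy along chosen walks from `u`; going to `v`, across `e` to `w` and back
  -- closes up, so the total ratio is `1`.
  have h1 := (((hk v).step (.inl ⟨hs, ht⟩)).trans (hk w).symm).eq_one_of_closed hbal
  have h2 := (hk w).ne_zero
  have h3 : ((n : ℕ) : ℚ) ≠ 0 := by simp
  field_simp at h1
  linarith

/-! #### The kernel of the incidence matrix -/

/-- The contribution of a source or target to the incidence matrix. -/
def endVal (k : V →₀ ℤ) : Option (V × ℕ+) → ℤ
  | none => 0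
  | some (v, n) => n * k v

variable (Γ) in
-- Identifies kernel vectors with integral potentials of finite support that vanish at the ends of
-- leaves.
theorem γ_apply (k : V →₀ ℤ) (e : E) : Γ.γ k e = endVal k (Γ.t e) - endVal k (Γ.s e) := by
  have hsingle : ∀ (v : V) (n : ℤ) (o : Option (V × ℕ+)),
      endVal (Finsupp.single v n) o = n * multAt o v := by
    classical
    rintro v n (_ | ⟨w, m⟩)
    · simp [endVal, multAt]
    · by_cases h : w = v
      · simp [endVal, multAt, h, mul_comm]
      · simp [endVal, multAt, h]
  have hadd : ∀ (k l : V →₀ ℤ) (o : Option (V × ℕ+)), endVal (k + l) o = endVal k o + endVal l o := by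
    rintro k l (_ | ⟨w, m⟩)
    · simp [endVal]
    · simp [endVal, mul_add]
  induction k using Finsupp.induction_linear with
  | zero =>
    have h0 : ∀ o : Option (V × ℕ+), endVal 0 o = 0 := by
      rintro (_ | ⟨w, m⟩) <;> simp [endVal]
    simp [h0]
  | add k l hk hl =>
    rw [map_add, Finsupp.add_apply, hk, hl, hadd, hadd]
    ring
  | single v n =>
    rw [hsingle, hsingle, γ, Finsupp.linearCombination_single, Finsupp.smul_apply, smul_eq_mul,
      column_apply, entry, mul_sub]

theorem Incident.connectedComponentMk_eq {v : V} {e : E} (h : Γ.Incident v e) :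
    Γ.incidenceGraph.connectedComponentMk (.inl v) =
      Γ.incidenceGraph.connectedComponentMk (.inr e) :=
  SimpleGraph.ConnectedComponent.sound (SimpleGraph.Adj.reachable (by exact h))

/-- Two vertices incident to the same edge are equal or linked. -/
theorem Incident.eq_or_link {v w : V} {e : E} (hv : Γ.Incident v e) (hw : Γ.Incident w e) :
    v = w ∨ ∃ a b, Γ.Link e v w a b := by
  rcases hv with ⟨a, ha⟩ | ⟨a, ha⟩ <;> rcases hw with ⟨b, hb⟩ | ⟨b, hb⟩
  · rw [ha] at hb
    simp only [Option.some.injEq, Prod.mk.injEq] at hb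
    exact .inl hb.1
  · exact .inr ⟨a, b, .inl ⟨ha, hb⟩⟩
  · exact .inr ⟨a, b, .inr ⟨ha, hb⟩⟩
  · rw [ha] at hb
    simp only [Option.some.injEq, Prod.mk.injEq] at hb
    exact .inl hb.1

theorem exists_holonomy_componentSubgraph {C : Γ.Component}
    (u v : {v : V | Γ.incidenceGraph.connectedComponentMk (.inl v) = C}) :
    ∃ c, (Γ.componentSubgraph C).Holonomy u v c := by
  have hreach : Γ.incidenceGraph.Reachable (.inl u.1) (.inl v.1) :=
    SimpleGraph.ConnectedComponent.exact (u.2.trans v.2.symm)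
  -- Paths in the incidence graph alternate between vertices and edges, so the induction must also
  -- say something at an edge: all vertices incident to it are reached.
  suffices h : ∀ x, Γ.incidenceGraph.Reachable (.inl u.1) x →
      ∀ v (hv : Γ.incidenceGraph.connectedComponentMk (.inl v) = C),
        (x = .inl v ∨ ∃ e, x = .inr e ∧ Γ.Incident v e) →
          ∃ c, (Γ.componentSubgraph C).Holonomy u ⟨v, hv⟩ c from
    h _ hreach v.1 v.2 (.inl rfl)
  intro x hx
  rw [SimpleGraph.reachable_iff_reflTransGen] at hx
  induction hx with
  | refl =>
    rintro v hv (h | ⟨e, h, -⟩)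
    · obtain rfl : u = ⟨v, hv⟩ := Subtype.ext (Sum.inl_injective h)
      exact ⟨1, .refl _⟩
    · cases h
  | @tail x y hx hxy ih =>
    rintro v hv (rfl | ⟨e, rfl, hve⟩)
    · rcases x with w | e
      · exact hxy.elim
      · exact ih v hv (.inr ⟨e, rfl, hxy⟩)
    · rcases x with w | f
      · have hwe : Γ.Incident w e := hxy
        have hw := hwe.connectedComponentMk_eq.trans
          (hve.connectedComponentMk_eq.symm.trans hv)
        obtain ⟨c, hc⟩ := ih w hw (.inl rfl)
        rcases hwe.eq_or_link hve with rfl | ⟨a, b, hl⟩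
        · exact ⟨c, hc⟩
        · exact ⟨_, hc.step (hl.subgraph (hve.connectedComponentMk_eq.symm.trans hv) hw hv)⟩
      · exact hxy.elim

/-- Balance yields a nowhere zero rational potential on `C`; cleared of denominators and extended by
zero it is a nonzero kernel vector. Edges of `C` have both ends in `C` as there are no leaves, and
other edges have none there. -/
theorem not_injective_γ_of_inEquilibrium {C : Γ.Component}
    (h : (Γ.componentSubgraph C).InEquilibrium) : ¬Function.Injective Γ.γ := by
  classical
  obtain ⟨hfin, hleaf, hbal⟩ := h
  have hends : ∀ e, Γ.incidenceGraph.connectedComponentMk (.inr e) = C →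
      ∃ u m v n, Γ.s e = some (u, m) ∧ Γ.t e = some (v, n) := by
    intro e he
    have h := hleaf ⟨e, he⟩
    rw [IsLeaf, not_or, ← ne_eq, ← ne_eq, Option.ne_none_iff_exists', Option.ne_none_iff_exists'] at h
    obtain ⟨⟨⟨u, m⟩, hs⟩, ⟨v, n⟩, ht⟩ := h
    exact ⟨u, m, v, n, restrictEnd_eq_some hs, restrictEnd_eq_some ht⟩
  -- A component without vertices would be a single edge with no ends, hence a leaf.
  obtain ⟨u, hu⟩ : ∃ u, Γ.incidenceGraph.connectedComponentMk (.inl u) = C := by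
    obtain ⟨u | e, rfl⟩ := C.exists_rep
    · exact ⟨u, rfl⟩
    · obtain ⟨u, m, -, -, hs, -⟩ := hends e rfl
      exact ⟨u, Incident.connectedComponentMk_eq (.inl ⟨m, hs⟩)⟩
  obtain ⟨k, hk, hk0⟩ := exists_isPotential hbal ⟨u, hu⟩
    fun v => exists_holonomy_componentSubgraph _ v
  obtain ⟨N, hN⟩ := IsLocalization.exist_integer_multiples_of_finite (nonZeroDivisors ℤ) k
  choose z hz using hN
  have hz' : ∀ v, (z v : ℚ) = (N : ℤ) * k v := fun v => by simpa using hz v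
  let κ : V →₀ ℤ := Finsupp.ofSupportFinite
    (fun v => if hv : Γ.incidenceGraph.connectedComponentMk (.inl v) = C then z ⟨v, hv⟩ else 0) (by
      refine Set.Finite.subset (Set.toFinite
        {v : V | Γ.incidenceGraph.connectedComponentMk (.inl v) = C}) fun v hv => ?_
      by_contra hv'
      exact hv (dif_neg hv'))
  have hκ : ∀ v (hv : Γ.incidenceGraph.connectedComponentMk (.inl v) = C), κ v = z ⟨v, hv⟩ :=
    fun v hv => dif_pos hv
  have hκ0 : ∀ v, Γ.incidenceGraph.connectedComponentMk (.inl v) ≠ C → κ v = 0 :=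
    fun v hv => dif_neg hv
  intro hinj
  have hker : Γ.γ κ = 0 := by
    ext e
    rw [γ_apply, Finsupp.zero_apply, sub_eq_zero]
    by_cases he : Γ.incidenceGraph.connectedComponentMk (.inr e) = C
    · obtain ⟨v, m, w, n, hs, ht⟩ := hends e he
      have hv := (Incident.connectedComponentMk_eq (.inl ⟨m, hs⟩)).trans he
      have hw := (Incident.connectedComponentMk_eq (.inr ⟨n, ht⟩)).trans he
      have hpot := (Link.subgraph (E' := {e : E | Γ.incidenceGraph.connectedComponentMk (.inr e) = C})
        (.inl ⟨hs, ht⟩) he hv hw).isPotential hk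
      rw [hs, ht, endVal, endVal, hκ v hv, hκ w hw]
      have : ((n : ℕ) : ℚ) * (z ⟨w, hw⟩ : ℚ) = ((m : ℕ) : ℚ) * (z ⟨v, hv⟩ : ℚ) := by
        rw [hz', hz']
        linear_combination (-(N : ℤ) : ℚ) * hpot
      exact_mod_cast this
    · have hend : ∀ o : Option (V × ℕ+), (∀ v n, o = some (v, n) → Γ.Incident v e) →
          endVal κ o = 0 := by
        rintro (_ | ⟨v, n⟩) ho
        · rfl
        · rw [endVal, hκ0 v fun hv => he ((ho v n rfl).connectedComponentMk_eq.symm.trans hv),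
            mul_zero]
      rw [hend (Γ.t e) fun v n h => .inr ⟨n, h⟩, hend (Γ.s e) fun v n h => .inl ⟨n, h⟩]
  have h0 : κ u = 0 := by rw [hinj (hker.trans (map_zero Γ.γ).symm), Finsupp.zero_apply]
  have h1 := hz' ⟨u, hu⟩
  rw [← hκ u hu, h0, Int.cast_zero] at h1
  exact mul_ne_zero (by exact_mod_cast nonZeroDivisors.coe_ne_zero N) (hk0 ⟨u, hu⟩) h1.symm

/-- If `k(v) ≠ 0`, an edge at `v` cannot be a leaf, and `k` is nonzero at its other end. So a
component meeting the support lies inside it: it is finite and leafless, and `k` is a nowhere zero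
potential on it, which balances all its cycles. -/
theorem exists_inEquilibrium_of_γ_eq_zero {k : V →₀ ℤ} (hk : Γ.γ k = 0) (hk0 : k ≠ 0) :
    ∃ C, (Γ.componentSubgraph C).InEquilibrium := by
  have hker : ∀ e, endVal k (Γ.t e) = endVal k (Γ.s e) := fun e => by
    rw [← sub_eq_zero, ← γ_apply, hk, Finsupp.zero_apply]
  obtain ⟨u, hu⟩ := Finsupp.ne_iff.1 hk0
  rw [Finsupp.zero_apply] at hu
  have hpos : ∀ m : ℕ+, ((m : ℕ) : ℤ) ≠ 0 := fun m => by simp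
  have hedge : ∀ v e, k v ≠ 0 → Γ.Incident v e →
      ∃ a b w, k w ≠ 0 ∧ Γ.Link e v w a b := by
    rintro v e hv (⟨a, ha⟩ | ⟨a, ha⟩)
    · have h := hker e
      rw [ha, endVal] at h
      rcases ht : Γ.t e with _ | ⟨w, b⟩
      · rw [ht, endVal] at h
        exact absurd h.symm (mul_ne_zero (hpos a) hv)
      · rw [ht, endVal] at h
        exact ⟨a, b, w, right_ne_zero_of_mul (h ▸ mul_ne_zero (hpos a) hv), .inl ⟨ha, ht⟩⟩
    · have h := hker e
      rw [ha, endVal] at h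
      rcases hs : Γ.s e with _ | ⟨w, b⟩
      · rw [hs, endVal] at h
        exact absurd h (mul_ne_zero (hpos a) hv)
      · rw [hs, endVal] at h
        exact ⟨a, b, w, right_ne_zero_of_mul (h ▸ mul_ne_zero (hpos a) hv), .inr ⟨ha, hs⟩⟩
  have hreach : ∀ x, Γ.incidenceGraph.Reachable (.inl u) x →
      (∀ v, x = .inl v → k v ≠ 0) ∧
      ∀ e, x = .inr e → ∃ a b v w, k v ≠ 0 ∧ k w ≠ 0 ∧ Γ.Link e v w a b := by
    intro x hx
    rw [SimpleGraph.reachable_iff_reflTransGen] at hx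
    induction hx with
    | refl =>
      refine ⟨fun v hv => ?_, fun e he => by cases he⟩
      rwa [← Sum.inl_injective hv]
    | @tail x y _ hxy ih =>
      rcases x with v | e <;> rcases y with w | f
      · exact hxy.elim
      · refine ⟨fun v hv => (by cases hv), fun e he => ?_⟩
        cases he
        obtain ⟨a, b, w, hw, hl⟩ := hedge v f (ih.1 v rfl) hxy
        exact ⟨a, b, v, w, ih.1 v rfl, hw, hl⟩
      · refine ⟨fun v hv => ?_, fun e he => by cases he⟩
        cases hv
        obtain ⟨a, b, v, v', hv, hv', hl⟩ := ih.2 e rfl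
        have hwe : Γ.Incident w e := hxy
        have hve : Γ.Incident v e := hl.elim (fun h => .inl ⟨_, h.1⟩) fun h => .inr ⟨_, h.1⟩
        rcases hve.eq_or_link hwe with rfl | ⟨a', b', hl'⟩
        · exact hv
        · rcases hl.eq_or_eq hl' with ⟨-, rfl, -⟩ | ⟨rfl, rfl, -⟩
          exacts [hv', hv]
      · exact hxy.elim
  have hC : ∀ x, Γ.incidenceGraph.connectedComponentMk x =
      Γ.incidenceGraph.connectedComponentMk (.inl u) → Γ.incidenceGraph.Reachable (.inl u) x :=
    fun x hx => (SimpleGraph.ConnectedComponent.exact hx).symm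
  refine ⟨Γ.incidenceGraph.connectedComponentMk (.inl u), ?_, ?_, ?_⟩
  · refine Set.Finite.to_subtype (k.support.finite_toSet.subset fun v hv => ?_)
    exact Finsupp.mem_support_iff.2 ((hreach _ (hC _ hv)).1 v rfl)
  · rintro ⟨e, he⟩
    obtain ⟨a, b, v, w, -, -, hl⟩ := (hreach _ (hC _ he)).2 e rfl
    have hve : Γ.Incident v e := hl.elim (fun h => .inl ⟨_, h.1⟩) fun h => .inr ⟨_, h.1⟩
    have hwe : Γ.Incident w e := hl.elim (fun h => .inr ⟨_, h.2⟩) fun h => .inl ⟨_, h.2⟩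
    have hl' : (Γ.componentSubgraph _).Link ⟨e, he⟩ _ _ a b := hl.subgraph he (hve.connectedComponentMk_eq.trans he)
      (hwe.connectedComponentMk_eq.trans he)
    rintro (h | h)
    all_goals
      rcases hl' with ⟨h₁, h₂⟩ | ⟨h₁, h₂⟩
    · exact Option.some_ne_none _ (h₁.symm.trans h)
    · exact Option.some_ne_none _ (h₂.symm.trans h)
    · exact Option.some_ne_none _ (h₂.symm.trans h)
    · exact Option.some_ne_none _ (h₁.symm.trans h)
  · rintro V' E' ⟨Γ', hΓ', hse⟩
    -- The directed cycle that witnesses the NND cycle is itself balanced, since `k` transports to a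
    -- potential on it.
    refine ⟨Γ', ?_, hse⟩
    have hpot : Γ.IsPotential fun v => k v := by
      intro e v m w n hs ht
      have h := hker e
      rw [hs, ht, endVal, endVal] at h
      have h' := congrArg (Int.cast : ℤ → ℚ) h.symm
      push_cast at h'
      exact h'
    obtain ⟨f, hf⟩ := hse.exists_equiv_isPotential
    have hpot' := (hf fun v => k (f.symm v).1.1).1 (by
      simpa [Function.comp_def, componentSubgraph] using (hpot.subgraph _ _).subgraph V' E')
    obtain ⟨n, v, e, a, b, hn, hvia⟩ := hΓ'
    refine ⟨n, v, e, a, b, hn, hvia, hvia.prod_eq_of_isPotential hpot' fun v => ?_⟩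
    exact_mod_cast (hreach _ (hC _ (f.symm v).1.2)).1 _ rfl

theorem γ_injective_iff :
    Function.Injective Γ.γ ↔ ∀ C : Γ.Component, ¬(Γ.componentSubgraph C).InEquilibrium := by
  refine ⟨fun h C hC => not_injective_γ_of_inEquilibrium hC h, fun h => ?_⟩
  rw [injective_iff_map_eq_zero]
  intro k hk
  by_contra hk0
  obtain ⟨C, hC⟩ := exists_inEquilibrium_of_γ_eq_zero hk hk0
  exact h C hC

end Multiquiver

end

theorem theorem4p5 {K V E : Type*} [Field K] [CharZero K] (Γ : Multiquiver V E) :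
    (∃! φ : Γ.Alg K →ₐ[K] WeylAlgebra K E, Γ.IsCanonicalRep φ) ∧
    ∀ φ : Γ.Alg K →ₐ[K] WeylAlgebra K E, Γ.IsCanonicalRep φ →
      List.TFAE [
        Function.Injective φ,
        Function.Injective Γ.γ,
        Maximal (fun S : Subalgebra K (Γ.Alg K) => ∀ a ∈ S, ∀ b ∈ S, a * b = b * a) (Γ.ρ K).range,
        ∀ C : Γ.Component, ¬(Γ.componentSubgraph C).InEquilibrium] := by
  refine ⟨⟨Γ.canonicalRep K, Γ.isCanonicalRep_canonicalRep K, fun φ hφ =>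
    hφ.ext (Γ.isCanonicalRep_canonicalRep K)⟩, fun φ hφ => ?_⟩
  obtain rfl := hφ.ext (Γ.isCanonicalRep_canonicalRep K)
  tfae_have 1 → 2 := Γ.γ_injective_of_canonicalRep_injective K
  tfae_have 2 → 1 := Γ.canonicalRep_injective K
  tfae_have 3 → 2 := Γ.γ_injective_of_maximal K
  tfae_have 2 → 3 := Γ.maximal_of_γ_injective K
  tfae_have 2 ↔ 4 := Multiquiver.γ_injective_iff
  tfae_finish
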